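/- Let $D\subset\mathbb C$ be a domain symmetric with respect to $\mathbb R$ such that $I=D\cap\mathbb R$ is an open interval (finite or infinite) containing $0$, and let $f:D\to\mathbb C$ be holomorphic with $f(I)\subset\mathbb R$, $f(D)=\mathbb C$, $f(0)=0$, and such that the only possible finite asymptotic value of $f$ is $0$. (A point $v\in\mathbb C$ is an asymptotic value of $f$ if there is a path $\gamma:[0,1)\to D$ with $\gamma(t)\to\partial D$, i.e. leaving every compact subset of $D$, and $f(\gamma(t))\to v$ as $t\to1^-$.) Assume that there is a minimal $c>0$ in $I$ at which $f|_I$ has a positive local maximum, and that one of the following holds: - ($f\in\mathcal E$) every critical value of $f$ lies in $\{0,1\}$; or - ($f\in\mathcal E_o$) $f$ is odd, every critical value of $f$ lies in $\{0,1,-1\}$, and moreover $f>0$ on $(0,c)$. Let $b\in(c,\infty]$ be the supremum of the $x>c$ such that $[c,x]\subset I$ and $f>0$ on $[c,x]$, let $J=[0,b)$ be the unimodal part of $f$, and for $0<a<b$ let $f_a(x)=af(x)$. Then: 1. (Positively oriented transversality.) Let $0<a<b$ and suppose that $c$ is periodic or eventually periodic for $f_a$. If $c$ is periodic of exact period $q$,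 then $$\frac{\frac{d}{dw}\left(f_w^{q}(c)-c\right)\big|_{w=a}}{Df_a^{q-1}(f_a(c))}>0 .$$ If $c$ is eventually periodic but not periodic, and $0<l<q$ are minimal with $f_a^q(c)=f_a^l(c)$ (so that $c,f_a(c),\dots,f_a^{q-1}(c)$ are distinct), then $$\frac{\frac{d}{dw}\left(f_w^{q}(c)-f_w^{l}(c)\right)\big|_{w=a}}{Df_a^{q-1}(f_a(c))}>0 .$$ 2. (Monotonicity.) The kneading sequence of $f_a:J\to\mathbb R$ is monotone increasing in $a\in(0,b)$: if $0<a\le a'<b$, then $\mathcal K(f_a)=\mathcal K(f_{a'})$ or $\mathcal K(f_a)\prec\mathcal K(f_{a'})$. Here $\mathcal K(f_a)=i_1i_2\cdots\in\{-1,0,1\}^{\{1,2,\dots\}}$, where $i_k$ is the sign of $f_a^k(c)-c$, and $\prec$ is the Milnor–Thurston order: $i_1i_2\cdots\prec j_1j_2\cdots$ if there is $n\ge1$ with $i_k=j_k$ for $1\le k<n$ and $\left(\prod_{k=1}^{n-1}(-i_k)\right)i_n<\left(\prod_{k=1}^{n-1}(-j_k)\right)j_n$. -/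

import Mathlib

open Set Filter Topology

/-- `v` is a (finite) asymptotic value of `f : D → ℂ`: `f` tends to `v` along some path
`γ : [0,1) → D` tending to the boundary of `D` (taken in the Riemann sphere), i.e. a path that
leaves every compact subset of `D`. -/
def IsAsymptoticValue (D : Set ℂ) (f : ℂ → ℂ) (v : ℂ) : Prop :=
  ∃ γ : ℝ → ℂ, ContinuousOn γ (Ico 0 1) ∧ MapsTo γ (Ico 0 1) D ∧
    (∀ K : Set ℂ, K ⊆ D → IsCompact K → ∀ᶠ t in 𝓝[<] (1 : ℝ), γ t ∉ K) ∧
    Tendsto (fun t => f (γ t)) (𝓝[<] (1 : ℝ)) (𝓝 v)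

/-- `v` is a critical value of `f : D → ℂ`. -/
def IsCriticalValue (D : Set ℂ) (f : ℂ → ℂ) (v : ℂ) : Prop :=
  ∃ z ∈ D, deriv f z = 0 ∧ f z = v

/-- Conditions (a), (b), (c): `D` is a domain symmetric with respect to `ℝ` which meets `ℝ` in an
(automatically open) interval containing `0`; `f` is holomorphic on `D`, real on `D ∩ ℝ`, maps `D`
onto `ℂ`, has no finite asymptotic value except possibly `0`, and `f 0 = 0`.
Values of `f` outside `D` play no role. -/
structure IsRealSurjective (D : Set ℂ) (f : ℂ → ℂ) : Prop where
  isOpen : IsOpen D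
  isPreconnected : IsPreconnected D
  symm : ∀ z ∈ D, (starRingEnd ℂ) z ∈ D
  interval : OrdConnected {x : ℝ | (x : ℂ) ∈ D}
  zero_mem : (0 : ℂ) ∈ D
  holo : DifferentiableOn ℂ f D
  real : ∀ x : ℝ, (x : ℂ) ∈ D → (f x).im = 0
  surj : f '' D = univ
  asymptotic : ∀ v : ℂ, IsAsymptoticValue D f v → v = 0
  map_zero : f 0 = 0

/-- `c` is the minimal `c > 0` in `D ∩ ℝ` at which the real function `f|ℝ` has a positive local
maximum. -/
def IsFirstPositiveMax (D : Set ℂ) (f : ℂ → ℂ) (c : ℝ) : Prop :=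
  IsLeast {x : ℝ | 0 < x ∧ (x : ℂ) ∈ D ∧ 0 < (f x).re ∧
    IsLocalMax (fun y : ℝ => (f y).re) x} c

/-- The class `ℰ`. -/
structure ClassE (D : Set ℂ) (f : ℂ → ℂ) : Prop extends IsRealSurjective D f where
  critical : ∀ v : ℂ, IsCriticalValue D f v → v = 1 ∨ v = 0
  exists_max : ∃ c : ℝ, IsFirstPositiveMax D f c

/-- The class `ℰ_o`. -/
structure ClassEo (D : Set ℂ) (f : ℂ → ℂ) : Prop extends IsRealSurjective D f where
  odd : ∀ z ∈ D, -z ∈ D ∧ f (-z) = -f z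
  critical : ∀ v : ℂ, IsCriticalValue D f v → v = 1 ∨ v = -1 ∨ v = 0
  exists_max : ∃ c : ℝ, IsFirstPositiveMax D f c

/-- The right end point `b ∈ (c, ∞]` of the unimodal part `[0, b)`: the supremum of the `x > c` such
that `[c, x] ⊆ D` and `f > 0` on `[c, x]`. -/
noncomputable def unimodalEnd (D : Set ℂ) (f : ℂ → ℂ) (c : ℝ) : EReal :=
  sSup ((fun x : ℝ => (x : EReal)) ''
    {x : ℝ | c < x ∧ ∀ y ∈ Icc c x, (y : ℂ) ∈ D ∧ 0 < (f y).re})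

/-- The family of real maps `f_a(x) = a f(x)`. -/
noncomputable def mulFamily (f : ℂ → ℂ) (a x : ℝ) : ℝ := a * (f x).re

/-- Positively oriented transversality at the parameter `a` of a one-parameter family `F` of real
maps with one marked (critical) point `c` which does not depend on the parameter.
If `c` is periodic of (exact) period `q`, then the critical relation is `R(w) = F_w^q(c) - c`.
If `c` is eventually periodic but not periodic, then `R(w) = F_w^q(c) - F_w^l(c)`, with `0 < l < q`
minimal such that `F_a^q(c) = F_a^l(c)`, i.e. `c, F_a(c), …, F_a^{q-1}(c)` are distinct.
The condition is `R'(a) / (F_a^{q-1})'(F_a(c)) > 0`. -/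
def PositiveTransversality (F : ℝ → ℝ → ℝ) (c a : ℝ) : Prop :=
  (∃ q : ℕ, 0 < q ∧ (F a)^[q] c = c ∧ (∀ k : ℕ, 0 < k → k < q → (F a)^[k] c ≠ c) ∧
    0 < deriv (fun w : ℝ => (F w)^[q] c - c) a / deriv ((F a)^[q - 1]) (F a c)) ∨
  (∃ l q : ℕ, 0 < l ∧ l < q ∧ (F a)^[q] c = (F a)^[l] c ∧
    InjOn (fun k : ℕ => (F a)^[k] c) (Iio q) ∧
    0 < deriv (fun w : ℝ => (F w)^[q] c - (F w)^[l] c) a / deriv ((F a)^[q - 1]) (F a c))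

/-- The kneading sequence `i_1 i_2 ⋯` of a unimodal map `g` with turning point `c`:
`i_k` is the sign of `g^k(c) - c`. Only the entries with `k ≥ 1` are used. -/
noncomputable def kneading (g : ℝ → ℝ) (c : ℝ) (k : ℕ) : SignType :=
  SignType.sign (g^[k] c - c)

/-- The (strict) Milnor–Thurston order on kneading sequences of unimodal maps with a maximum at the
turning point: at the first index `n` where the sequences differ, the signs are compared after
multiplication with the orientation of `g^{n-1}` at `g(c)`. The map `g` preserves orientation to the
left of `c` and reverses it to the right of `c`, so its orientation at a point with sign `i_k` is
`-i_k`. -/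
def KneadingLT (i j : ℕ → SignType) : Prop :=
  ∃ n : ℕ, 1 ≤ n ∧ (∀ k : ℕ, 1 ≤ k → k < n → i k = j k) ∧
    (∏ k ∈ Finset.Ico 1 n, -i k) * i n < (∏ k ∈ Finset.Ico 1 n, -j k) * j n

/-- The associated weak order: the two sequences agree, or the first is strictly smaller. -/
def KneadingLE (i j : ℕ → SignType) : Prop :=
  (∀ k : ℕ, 1 ≤ k → i k = j k) ∨ KneadingLT i j

/-! Let `μ n` and `L n` be the derivatives of `w f(x)` in `x` and in `w` along the orbit of `c` at
the parameter `a`. The chain rule expresses the derivative of `f_w^n(c)` by the recursion `W (n+1) =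
L n + μ n W n`. Weighting `L n` by `ρ ^ n` deforms the quotient of the theorem into `F ρ = (W_ρ q -
ρ^(q-l) W_ρ l) / ∏ μ`, with `F 0 = 1` and `F 1` the quantity to be shown positive. It suffices that
`F` has no zero on `(0, 1]` (`weightedDeriv_sub_div_pos`).

A zero at `ρ` is an eigenvector, with eigenvalue `ρ⁻¹`, of the operator obtained by linearising the
following lifting. Move the orbit points holomorphically over the disc, keeping `c` fixed and all
points distinct and nonzero (for odd `f`, also never opposite). Then the quotients `h_{i+1} / h_1`
with `i ≠ 0` avoid all critical values and the only possible finite asymptotic value `0`, so they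
lift through `f` to a new motion (`exists_motionLift`). All iterated lifts keep the same base points
and omit `0` and `c`, so Schottky's theorem bounds them uniformly (`exists_motion_bound`), and with
them their Taylor coefficients.

For `ρ < 1` the first-order coefficients would grow like `ρ^(-k)`: a contradiction
(`no_expanding_eigenvector`). For `ρ = 1` the relation does not vanish identically in the parameter,
because for small parameters the critical orbit is strictly decreasing; it therefore has a finite
order `m`. Lifting the true parameter motion creates a defect of order `m` at every step, and the
sums of the `m`-th coefficients contradict the bound if the first derivative vanishes
(`no_degenerate_relation`).

Monotonicity follows by induction on the length of the prefix. While the prefix is constant and has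
no zero, `f_t^{n+1}(c) - c` can vanish only when `c` has exact period `n + 1`. There transversality
fixes the direction of crossing, which is the direction of the Milnor–Thurston order. -/

/-! ### Theorems of Bloch and Schottky. -/

open Metric in
/-- A holomorphic function without zeros on the unit disc has a holomorphic logarithm. -/
theorem exists_log_on_ball {u : ℂ → ℂ} (hu : DifferentiableOn ℂ u (ball 0 1))
    (h0 : ∀ z ∈ ball (0 : ℂ) 1, u z ≠ 0) :
    ∃ l : ℂ → ℂ, DifferentiableOn ℂ l (ball 0 1) ∧ l 0 = Complex.log (u 0) ∧
      ∀ z ∈ ball (0 : ℂ) 1, Complex.exp (l z) = u z := by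
  have hd : DifferentiableOn ℂ (fun z => deriv u z / u z) (ball 0 1) :=
    (hu.deriv isOpen_ball).div hu h0
  obtain ⟨g, hg⟩ := hd.isExactOn_ball
  have h1 : (0 : ℂ) ∈ ball (0 : ℂ) 1 := by simp
  refine ⟨fun z => g z - g 0 + Complex.log (u 0), ?_, by simp, ?_⟩
  · intro z hz
    exact (((hg z hz).differentiableAt.sub_const _).add_const _).differentiableWithinAt
  · have key : ∀ z ∈ ball (0 : ℂ) 1,
        HasDerivAt (fun z => u z * Complex.exp (-(g z - g 0 + Complex.log (u 0)))) 0 z := by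
      intro z hz
      have hu' := (hu.differentiableAt (isOpen_ball.mem_nhds hz)).hasDerivAt
      have := hu'.mul (((((hg z hz).sub_const (g 0)).add_const (Complex.log (u 0))).neg).cexp)
      refine this.congr_deriv ?_
      field_simp [h0 z hz]
      ring
    intro z hz
    have hc := (convex_ball (0 : ℂ) 1).is_const_of_fderivWithin_eq_zero (𝕜 := ℂ)
      (f := fun z => u z * Complex.exp (-(g z - g 0 + Complex.log (u 0))))
      (fun w hw => (key w hw).differentiableAt.differentiableWithinAt)
      (fun w hw => by
        rw [fderivWithin_of_isOpen isOpen_ball hw]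
        ext; simpa using (key w hw).deriv) h1 hz
    simp only [sub_self, zero_add] at hc
    rw [Complex.exp_neg, Complex.exp_neg, Complex.exp_log (h0 0 h1), mul_inv_cancel₀ (h0 0 h1)] at hc
    field_simp at hc
    exact hc

open Metric in
/-- If the image of a disc under a holomorphic function contains no disc of radius `R`, then the
derivative at the centre is bounded (Bloch). -/
theorem bloch_bound {F : ℂ → ℂ} {c : ℂ} {r R : ℝ} (hr : 0 < r)
    (hF : DifferentiableOn ℂ F (ball c (2 * r)))
    (hR : ∀ w : ℂ, ∃ v ∈ ball w R, ∀ z ∈ ball c (2 * r), F z ≠ v) :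
    ‖deriv F c‖ * r ≤ 128 * R := by
  have hdF : DifferentiableOn ℂ (deriv F) (ball c (2 * r)) := hF.deriv isOpen_ball
  have hsub : closedBall c r ⊆ ball c (2 * r) := closedBall_subset_ball (by linarith)
  -- Landau's device: at a point maximising `‖F'‖` times the distance to the boundary, `‖F'‖` at
  -- most doubles on the disc of half that distance.
  have hcont : ContinuousOn (fun z => ‖deriv F z‖ * (r - dist z c)) (closedBall c r) := by
    apply ContinuousOn.mul (hdF.continuousOn.mono hsub).norm
    fun_prop
  obtain ⟨z₀, hz₀, hmax⟩ := (isCompact_closedBall c r).exists_isMaxOn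
    ⟨c, mem_closedBall_self hr.le⟩ hcont
  have hc : ‖deriv F c‖ * (r - dist c c) ≤ ‖deriv F z₀‖ * (r - dist z₀ c) :=
    hmax (mem_closedBall_self hr.le : c ∈ closedBall c r)
  rw [dist_self, sub_zero] at hc
  refine le_trans hc ?_
  have hz₀' : dist z₀ c ≤ r := hz₀
  by_contra! hlt
  have hRpos : 0 < R := by
    obtain ⟨v, hv, -⟩ := hR 0
    exact pos_of_mem_ball hv
  set d := (r - dist z₀ c) / 2 with hd
  set m := ‖deriv F z₀‖ with hm
  have hmd : 128 * R < m * (2 * d) := by rw [hd]; convert! hlt using 2; ring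
  have hdpos : 0 < d := by
    rcases hz₀'.lt_or_eq with h | h
    · rw [hd]; linarith
    · have : d = 0 := by rw [hd, h]; simp
      rw [this] at hmd; linarith
  have hmpos : 0 < m := by
    by_contra! h
    nlinarith
  have hbd : ∀ z ∈ ball z₀ d, ‖deriv F z‖ ≤ 2 * m := by
    intro z hz
    have h1 : dist z c ≤ d + dist z₀ c :=
      (dist_triangle z z₀ c).trans (by have := mem_ball.1 hz; linarith)
    have h3 : ‖deriv F z‖ * (r - dist z c) ≤ ‖deriv F z₀‖ * (r - dist z₀ c) :=
      hmax (show z ∈ closedBall c r by rw [mem_closedBall]; linarith)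
    have h2 : d ≤ r - dist z c := by linarith
    have h4 : ‖deriv F z‖ * d ≤ ‖deriv F z‖ * (r - dist z c) := by gcongr
    have h5 : m * (r - dist z₀ c) = 2 * m * d := by rw [hd]; ring
    have h6 : ‖deriv F z‖ * d ≤ 2 * m * d := by linarith
    exact le_of_mul_le_mul_right h6 hdpos
  have hsubd : ball z₀ d ⊆ ball c (2 * r) := by
    intro z hz
    have := dist_triangle z z₀ c
    rw [mem_ball] at hz ⊢
    linarith
  have hschwarz : ∀ z ∈ ball z₀ (d / 8), ‖deriv F z - deriv F z₀‖ ≤ m / 2 := by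
    intro z hz
    have hz' : z ∈ ball z₀ d := ball_subset_ball (by linarith) hz
    -- Schwarz lemma for `F' - F'(z₀)`, which is bounded by `3 m ≤ 4 m`; the radius `d / 8` is
    -- chosen to give `m / 2`.
    have := Complex.dist_le_div_mul_dist_of_mapsTo_ball (f := deriv F) (c := z₀) (R₁ := d)
      (R₂ := 4 * m) (z := z) (hdF.mono hsubd) (fun w hw => by
        have h7 := norm_sub_le (deriv F w) (deriv F z₀)
        have h8 := hbd w hw
        simp only [mem_closedBall, dist_eq_norm]
        linarith) hz'
    rw [dist_eq_norm] at this
    refine this.trans ?_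
    have hz8 : dist z z₀ ≤ d / 8 := (mem_ball.1 hz).le
    calc 4 * m / d * dist z z₀ ≤ 4 * m / d * (d / 8) := by gcongr
      _ = m / 2 := by field_simp; norm_num
  have hlow : ∀ z ∈ ball z₀ (d / 8), m / 2 * ‖z - z₀‖ ≤ ‖F z - F z₀‖ := by
    intro z hz
    have := (convex_ball z₀ (d / 8)).norm_image_sub_le_of_norm_hasDerivWithin_le
      (f := fun z => F z - deriv F z₀ * z) (f' := fun z => deriv F z - deriv F z₀) (C := m / 2)
      (x := z₀) (y := z)
      (fun w hw => by
        have hw' : w ∈ ball c (2 * r) := hsubd (ball_subset_ball (by linarith) hw)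
        have h9 := (hF.differentiableAt (isOpen_ball.mem_nhds hw')).hasDerivAt
        have h10 := h9.sub ((hasDerivAt_id w).const_mul (deriv F z₀))
        simpa [Pi.sub_def] using h10.hasDerivWithinAt)
      hschwarz (mem_ball_self (by linarith)) hz
    have h11 : F z - deriv F z₀ * z - (F z₀ - deriv F z₀ * z₀) =
      (F z - F z₀) - deriv F z₀ * (z - z₀) := by ring
    rw [h11] at this
    have h12 : m * ‖z - z₀‖ = ‖deriv F z₀ * (z - z₀)‖ := by rw [norm_mul]
    have h13 := norm_sub_norm_le (deriv F z₀ * (z - z₀)) (F z - F z₀)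
    rw [norm_sub_rev (deriv F z₀ * (z - z₀))] at h13
    linarith
  have hsub16 : closedBall z₀ (d / 16) ⊆ ball z₀ (d / 8) := closedBall_subset_ball (by linarith)
  have hsubF : closedBall z₀ (d / 16) ⊆ ball c (2 * r) :=
    hsub16.trans ((ball_subset_ball (by linarith)).trans hsubd)
  -- On the circle of radius `d / 16` the displacement is at least `m d / 32`, so the image covers a
  -- disc of radius `m d / 64`. This exceeds `R` because `128 R < 2 m d`.
  have himg := DiffContOnCl.ball_subset_image_closedBall (f := F) (z₀ := z₀) (r := d / 16)
    (ε := m * d / 32) ((hF.mono (by rwa [closure_ball _ (by linarith)])).diffContOnCl)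
    (by linarith) (fun z hz => by
      have h14 := hlow z (hsub16 (sphere_subset_closedBall hz))
      rw [mem_sphere_iff_norm.1 hz] at h14
      linarith) (by
      apply Filter.Eventually.frequently (f := 𝓝[≠] z₀) ?_ |>.filter_mono nhdsWithin_le_nhds
      filter_upwards [self_mem_nhdsWithin, mem_nhdsWithin_of_mem_nhds
        (ball_mem_nhds z₀ (show 0 < d / 8 by linarith))] with z hz hz' heq
      have h15 := hlow z hz'
      have h16 : 0 < ‖z - z₀‖ := norm_pos_iff.2 (sub_ne_zero.2 hz)
      rw [heq, sub_self, norm_zero] at h15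
      have : 0 < m / 2 * ‖z - z₀‖ := by positivity
      linarith)
  obtain ⟨v, hv, hv'⟩ := hR (F z₀)
  obtain ⟨z, hz, rfl⟩ := himg (show v ∈ ball (F z₀) (m * d / 32 / 2) from
    ball_subset_ball (by linarith) hv)
  exact hv' z (hsubF hz) rfl

/-- The points where `sinh ^ 2` takes integral values are `1`-dense on the real line. -/
theorem exists_sinh_sq_int (x : ℝ) : ∃ s : ℝ, |s - x| ≤ 1 ∧ ∃ n : ℤ, Real.sinh s ^ 2 = n := by
  wlog hx : 0 ≤ x generalizing x
  · obtain ⟨s, hs, n, hn⟩ := this (-x) (by linarith)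
    refine ⟨-s, ?_, n, by simpa using hn⟩
    rw [abs_le] at hs ⊢
    constructor <;> linarith [hs.1, hs.2]
  -- `sinh ^ 2` gains at least `1` over `[x, x + 1]`, so it passes an integer there.
  have h1 : Real.sinh x ^ 2 + 1 ≤ Real.sinh (x + 1) ^ 2 := by
    rw [Real.sinh_add]
    have a1 : 0 ≤ Real.sinh x := Real.sinh_nonneg_iff.2 hx
    have a2 : (1 : ℝ) ≤ Real.sinh 1 := Real.self_le_sinh_iff.2 zero_le_one
    have a3 : (1 : ℝ) ≤ Real.cosh 1 := Real.one_le_cosh 1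
    have a4 : (1 : ℝ) ≤ Real.cosh x := Real.one_le_cosh x
    have a5 : Real.sinh x ≤ Real.sinh x * Real.cosh 1 := le_mul_of_one_le_right a1 a3
    have a6 : 1 ≤ Real.cosh x * Real.sinh 1 := by nlinarith
    nlinarith
  have h2 : Real.sinh x ^ 2 ≤ ⌈Real.sinh x ^ 2⌉ := Int.le_ceil _
  have h3 : (⌈Real.sinh x ^ 2⌉ : ℝ) ≤ Real.sinh (x + 1) ^ 2 :=
    (Int.ceil_lt_add_one _).le.trans h1
  obtain ⟨s, hs, hs'⟩ := intermediate_value_Icc (show x ≤ x + 1 by linarith)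
    (f := fun s => Real.sinh s ^ 2) (by fun_prop) ⟨h2, h3⟩
  exact ⟨s, by rw [abs_le]; constructor <;> linarith [hs.1, hs.2], _, hs'⟩

/-- The points where `cosh ^ 2` takes integral values are `3`-dense in the plane. -/
theorem exists_cosh_sq_int (w : ℂ) :
    ∃ v ∈ Metric.ball w 3, ∃ n : ℤ, Complex.cosh v ^ 2 = n := by
  obtain ⟨s, hs, n, hn⟩ := exists_sinh_sq_int w.re
  set k := round (w.im / Real.pi) with hk
  have hk' : |w.im / Real.pi - k| ≤ 1 / 2 := abs_sub_round _
  -- The point is within `1` horizontally and `π / 2 < 2` vertically, whence the radius `3`. Adding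
  -- `k π i` changes `cosh` at most by a sign, and `cosh ^ 2 = sinh ^ 2 + 1`.
  refine ⟨(s : ℂ) + (k * Real.pi : ℝ) * Complex.I, ?_, n + 1, ?_⟩
  · rw [Metric.mem_ball, dist_eq_norm]
    refine (Complex.norm_le_abs_re_add_abs_im _).trans_lt ?_
    have hpi := Real.pi_lt_four
    have h1 : |k * Real.pi - w.im| ≤ 1 / 2 * Real.pi := by
      have : k * Real.pi - w.im = -((w.im / Real.pi - k) * Real.pi) := by
        field_simp; ring
      rw [this, abs_neg, abs_mul, abs_of_pos Real.pi_pos]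
      gcongr
    simp only [Complex.sub_re, Complex.add_re, Complex.ofReal_re, Complex.mul_re, Complex.I_re,
      mul_zero, Complex.ofReal_im, Complex.I_im, mul_one, sub_self, add_zero, Complex.sub_im,
      Complex.add_im, Complex.mul_im, zero_add]
    linarith
  · rw [Complex.cosh_add, Complex.cosh_mul_I, Complex.sinh_mul_I]
    have h1 : Complex.sin ((k * Real.pi : ℝ) : ℂ) = 0 := by
      rw [← Complex.ofReal_sin, Real.sin_int_mul_pi]; simp
    have h2 : Complex.cos ((k * Real.pi : ℝ) : ℂ) ^ 2 = 1 := by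
      have := Complex.sin_sq_add_cos_sq ((k * Real.pi : ℝ) : ℂ)
      rw [h1] at this; simpa using this
    have h3 : Complex.cosh s ^ 2 = n + 1 := by
      rw [Complex.cosh_sq, ← Complex.ofReal_sinh]
      exact_mod_cast congrArg (fun t : ℝ => (t : ℂ) + 1) hn
    rw [h1, zero_mul, mul_zero, add_zero, mul_pow, h2, h3]
    push_cast; ring

open Metric in
/-- Schottky's theorem: holomorphic functions on the unit disc which omit `0` and `1` and have a
given value at the centre are uniformly bounded on a smaller disc. -/
theorem schottky (p : ℂ) : ∃ C : ℝ, ∀ g : ℂ → ℂ, DifferentiableOn ℂ g (ball 0 1) → g 0 = p →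
    (∀ z ∈ ball (0 : ℂ) 1, g z ≠ 0 ∧ g z ≠ 1) → ∀ z ∈ ball (0 : ℂ) (1 / 2), ‖g z‖ ≤ C := by
  -- `F₀` is the value at `0` of the function `F` built below. It depends on `p` alone because each
  -- logarithm is normalised at `0` by the principal branch.
  set L₀ : ℂ := Complex.log p / (2 * Real.pi * Complex.I) with hL₀
  set F₀ : ℂ := Complex.log (Complex.exp (Complex.log L₀ / 2) - Complex.exp (Complex.log (L₀ - 1) / 2))
    with hF₀
  obtain ⟨C, hC⟩ := (isCompact_closedBall F₀ 768).exists_bound_of_continuousOn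
    (f := fun w => Complex.exp (2 * Real.pi * Complex.I * Complex.cosh w ^ 2))
    (by fun_prop)
  refine ⟨C, fun g hg hgp hg01 z hz => ?_⟩
  have hpi : (2 * Real.pi * Complex.I : ℂ) ≠ 0 := Complex.two_pi_I_ne_zero
  obtain ⟨l, hl, hl0, hlexp⟩ := exists_log_on_ball hg (fun z hz => (hg01 z hz).1)
  set L : ℂ → ℂ := fun z => l z / (2 * Real.pi * Complex.I) with hL
  have hLexp : ∀ z ∈ ball (0 : ℂ) 1, Complex.exp (2 * Real.pi * Complex.I * L z) = g z := by
    intro z hz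
    rw [← hlexp z hz, hL]
    congr 1
    field_simp
  have hLint : ∀ z ∈ ball (0 : ℂ) 1, ∀ n : ℤ, L z ≠ n := by
    intro z hz n hn
    apply (hg01 z hz).2
    rw [← hLexp z hz, hn, mul_comm]
    exact Complex.exp_int_mul_two_pi_mul_I n
  have hLd : DifferentiableOn ℂ L (ball 0 1) := hl.div_const _
  obtain ⟨A, hA, hA0, hAexp⟩ := exists_log_on_ball hLd
    (fun z hz => by simpa using hLint z hz 0)
  obtain ⟨B, hB, hB0, hBexp⟩ := exists_log_on_ball (hLd.sub_const 1)
    (fun z hz => sub_ne_zero.2 (by simpa using hLint z hz 1))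
  have hAsq : ∀ z ∈ ball (0 : ℂ) 1, Complex.exp (A z / 2) ^ 2 = L z := by
    intro z hz
    rw [← Complex.exp_nat_mul, ← hAexp z hz]
    congr 1; push_cast; ring
  have hBsq : ∀ z ∈ ball (0 : ℂ) 1, Complex.exp (B z / 2) ^ 2 = L z - 1 := by
    intro z hz
    rw [← Complex.exp_nat_mul, ← hBexp z hz]
    congr 1; push_cast; ring
  -- `√L - √(L - 1)` and `√L + √(L - 1)` are mutually inverse. The first is therefore some `exp F`,
  -- and then `cosh F = √L`; so `F` omits every point where `cosh ^ 2` is an integer.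
  have hAB : ∀ z ∈ ball (0 : ℂ) 1, (Complex.exp (A z / 2) - Complex.exp (B z / 2)) *
      (Complex.exp (A z / 2) + Complex.exp (B z / 2)) = 1 := by
    intro z hz
    have h1 := hAsq z hz
    have h2 := hBsq z hz
    linear_combination h1 - h2
  obtain ⟨F, hF, hF0, hFexp⟩ := exists_log_on_ball
    (u := fun z => Complex.exp (A z / 2) - Complex.exp (B z / 2))
    ((hA.div_const 2).cexp.sub (hB.div_const 2).cexp)
    (fun z hz => left_ne_zero_of_mul_eq_one (hAB z hz))
  have hcosh : ∀ z ∈ ball (0 : ℂ) 1, Complex.cosh (F z) ^ 2 = L z := by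
    intro z hz
    have h1 : Complex.exp (-F z) = Complex.exp (A z / 2) + Complex.exp (B z / 2) := by
      rw [Complex.exp_neg, hFexp z hz]
      exact inv_eq_of_mul_eq_one_right (hAB z hz)
    rw [← hAsq z hz, Complex.cosh, h1, hFexp z hz]
    ring
  have hFomit : ∀ w : ℂ, ∃ v ∈ ball w 3, ∀ z ∈ ball (0 : ℂ) 1, F z ≠ v := by
    intro w
    obtain ⟨v, hv, n, hn⟩ := exists_cosh_sq_int w
    refine ⟨v, hv, fun z hz h => hLint z hz n ?_⟩
    rw [← hcosh z hz, h, hn]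
  -- `1536 = 4 · 128 · 3`, from radius `1 / 4` and density `3`; integrating over a length `1 / 2`
  -- gives `768`.
  have hderiv : ∀ z ∈ ball (0 : ℂ) (1 / 2), ‖deriv F z‖ ≤ 1536 := by
    intro z hz
    have hsub : ball z (2 * (1 / 4)) ⊆ ball (0 : ℂ) 1 := by
      apply ball_subset_ball'
      have := mem_ball.1 hz
      linarith
    have := bloch_bound (F := F) (c := z) (r := 1 / 4) (R := 3) (by norm_num) (hF.mono hsub)
      (fun w => by
        obtain ⟨v, hv, h⟩ := hFomit w
        exact ⟨v, hv, fun z hz => h z (hsub hz)⟩)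
    linarith
  have hsub : ball (0 : ℂ) (1 / 2) ⊆ ball (0 : ℂ) 1 := ball_subset_ball (by norm_num)
  have hFz : F z ∈ closedBall F₀ 768 := by
    have := (convex_ball (0 : ℂ) (1 / 2)).norm_image_sub_le_of_norm_deriv_le (f := F) (C := 1536)
      (x := 0) (y := z) (fun w hw => hF.differentiableAt (isOpen_ball.mem_nhds (hsub hw)))
      hderiv (by simp) hz
    have h0 : F 0 = F₀ := by
      rw [hF0, hF₀]
      simp only [hA0, hB0, hL, hl0, hgp, hL₀]
    rw [h0, sub_zero] at this
    rw [mem_closedBall, dist_eq_norm]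
    have h1 : ‖z‖ < 1 / 2 := by simpa using hz
    linarith
  have := hC (F z) hFz
  rwa [hcosh z (hsub hz), hLexp z (hsub hz)] at this

/-! ### Lifting through `f` away from critical and asymptotic values. -/

/-- The part of the domain where `f` is locally invertible. -/
noncomputable abbrev RegularPoints (D : Set ℂ) (f : ℂ → ℂ) : Type :=
  {z : ℂ // z ∈ D ∧ deriv f z ≠ 0}

/-- The map `f` on its regular points. -/
noncomputable def regularMap (D : Set ℂ) (f : ℂ → ℂ) (z : RegularPoints D f) : ℂ := f z.1

section Regular

variable {D : Set ℂ} {f : ℂ → ℂ}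

theorem hasStrictDerivAt_of_mem (hD : IsOpen D) (hf : DifferentiableOn ℂ f D) {z : ℂ}
    (hz : z ∈ D) : HasStrictDerivAt f (deriv f z) z := by
  have h := (hf.analyticAt (hD.mem_nhds hz)).hasStrictDerivAt
  exact h

theorem exists_local_left_inverse (hD : IsOpen D) (hf : DifferentiableOn ℂ f D) {z : ℂ}
    (hz : z ∈ D) (h' : deriv f z ≠ 0) :
    ∃ ψ : ℂ → ℂ, HasStrictDerivAt ψ (deriv f z)⁻¹ (f z) ∧ ∀ᶠ w in 𝓝 z, ψ (f w) = w :=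
  ⟨_, (hasStrictDerivAt_of_mem hD hf hz).to_localInverse h',
    (hasStrictDerivAt_of_mem hD hf hz).eventually_left_inverse h'⟩

theorem isLocalHomeomorph_regularMap (hD : IsOpen D) (hf : DifferentiableOn ℂ f D) :
    IsLocalHomeomorph (regularMap D f) := by
  have hopen : IsOpen {z : ℂ | z ∈ D ∧ deriv f z ≠ 0} := by
    have := ((hf.deriv hD).continuousOn).isOpen_inter_preimage hD isOpen_compl_singleton (t := {0}ᶜ)
    exact this
  have h1 : IsLocalHomeomorphOn f {z : ℂ | z ∈ D ∧ deriv f z ≠ 0} := by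
    apply IsLocalHomeomorphOn.mk
    rintro z ⟨hz, hz'⟩
    have hs := (hasStrictDerivAt_of_mem hD hf hz).hasStrictFDerivAt_equiv hz'
    exact ⟨hs.toOpenPartialHomeomorph f, hs.mem_toOpenPartialHomeomorph_source, fun _ _ => rfl⟩
  have h2 : IsLocalHomeomorph (Subtype.val : {z : ℂ | z ∈ D ∧ deriv f z ≠ 0} → ℂ) :=
    hopen.isOpenEmbedding_subtypeVal.isLocalHomeomorph
  rw [isLocalHomeomorph_iff_isLocalHomeomorphOn_univ] at h2 ⊢
  exact h1.comp h2 (fun z _ => z.2)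

theorem IsCriticalValue.regular {z v : ℂ} (hz : z ∈ D) (hv : f z = v)
    (h : ¬ IsCriticalValue D f v) : deriv f z ≠ 0 := fun h0 => h ⟨z, hz, h0, hv⟩

/-- Stopping the clock at `min S T` makes both partial lifts global lifts of the same path, to which
uniqueness for local homeomorphisms applies. -/
theorem partial_lift_unique (hD : IsOpen D) (hf : DifferentiableOn ℂ f D) {β : ℝ → ℂ}
    {e : RegularPoints D f} {S T : ℝ} (hS : 0 ≤ S) (hT : 0 ≤ T) {γ δ : ℝ → RegularPoints D f}
    (hγ : Continuous γ) (hδ : Continuous δ) (hγ0 : γ 0 = e) (hδ0 : δ 0 = e)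
    (hγβ : ∀ t ≤ S, regularMap D f (γ t) = β t) (hδβ : ∀ t ≤ T, regularMap D f (δ t) = β t)
    {t : ℝ} (htS : t ≤ S) (htT : t ≤ T) : γ t = δ t := by
  have := (T2Space.isSeparatedMap (regularMap D f)).eq_of_comp_eq
    (isLocalHomeomorph_regularMap hD hf).isLocallyInjective (A := ℝ)
    (g₁ := fun t => γ (min t (min S T))) (g₂ := fun t => δ (min t (min S T)))
    (by fun_prop) (by fun_prop) (by
      ext t
      simp only [Function.comp_apply]
      rw [hγβ _ ((min_le_right _ _).trans (min_le_left _ _)),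
        hδβ _ ((min_le_right _ _).trans (min_le_right _ _))]) 0
    (by simp [hS, hT, hγ0, hδ0])
  have := congrFun this t
  simpa [htS, htT] using this

/-- A path which lifts on all half lines `t ≤ T` with `T < S` also lifts beyond `S`, since its value
at `S` is not an asymptotic value. -/
theorem partial_lift_extend (hD : IsOpen D) (hf : DifferentiableOn ℂ f D) {β : ℝ → ℂ}
    (hβ : Continuous β) (hcrit : ∀ t, ¬ IsCriticalValue D f (β t))
    (hasy : ∀ t, ¬ IsAsymptoticValue D f (β t)) {e : RegularPoints D f} {S : ℝ} (hS : 0 < S)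
    (hlift : ∀ T ≥ 0, T < S → ∃ γ : ℝ → RegularPoints D f, Continuous γ ∧ γ 0 = e ∧
      ∀ t ≤ T, regularMap D f (γ t) = β t) :
    ∃ T > S, ∃ γ : ℝ → RegularPoints D f, Continuous γ ∧ γ 0 = e ∧
      ∀ t ≤ T, regularMap D f (γ t) = β t := by
  have : Nonempty (RegularPoints D f) := ⟨e⟩
  choose! Γ hΓc hΓ0 hΓβ using hlift
  -- `m t` is a time strictly between `t` and `S`, so `Γ (m t)` is a lift valid a little beyond `t`;
  -- uniqueness glues these into `γ`.
  set m : ℝ → ℝ := fun t => (max t 0 + S) / 2 with hm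
  have hm1 : ∀ t < S, 0 ≤ m t ∧ m t < S ∧ t < m t := by
    intro t ht
    have h1 : 0 ≤ max t 0 := le_max_right _ _
    have h2 : max t 0 < S := max_lt ht hS
    have h3 : t ≤ max t 0 := le_max_left _ _
    simp only [hm]
    refine ⟨by linarith, by linarith, by linarith⟩
  set γ : ℝ → RegularPoints D f := fun t => Γ (m t) t with hγ
  have hγeq : ∀ T ≥ 0, T < S → ∀ t ≤ T, γ t = Γ T t := by
    intro T hT hTS t ht
    obtain ⟨h1, h2, h3⟩ := hm1 t (ht.trans_lt hTS)
    exact partial_lift_unique hD hf h1 hT (hΓc _ h1 h2) (hΓc _ hT hTS) (hΓ0 _ h1 h2)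
      (hΓ0 _ hT hTS) (hΓβ _ h1 h2) (hΓβ _ hT hTS) h3.le ht
  have hγβ : ∀ t < S, regularMap D f (γ t) = β t := by
    intro t ht
    obtain ⟨h1, h2, h3⟩ := hm1 t ht
    exact hΓβ _ h1 h2 t h3.le
  have hγc : ContinuousOn γ (Iio S) := by
    intro t ht
    obtain ⟨h1, h2, h3⟩ := hm1 t ht
    refine ContinuousAt.continuousWithinAt (((hΓc _ h1 h2).continuousAt (x := t)).congr ?_)
    filter_upwards [Iio_mem_nhds h3] with s hs
    exact (hγeq _ h1 h2 s (le_of_lt hs)).symm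
  have hβlim : Tendsto (fun t => f (γ t).1) (𝓝[<] S) (𝓝 (β S)) := by
    refine ((hβ.tendsto S).mono_left nhdsWithin_le_nhds).congr' ?_
    filter_upwards [self_mem_nhdsWithin] with t ht
    exact (hγβ t ht).symm
  -- Otherwise `γ`, reparametrised to `[0, 1)`, would leave every compact subset of `D` and make `β
  -- S` an asymptotic value.
  obtain ⟨K, hKD, hK, hKf⟩ : ∃ K ⊆ D, IsCompact K ∧ ∃ᶠ t in 𝓝[<] S, (γ t).1 ∈ K := by
    by_contra! hcon
    have hre : Tendsto (fun s : ℝ => s * S) (𝓝[<] 1) (𝓝[<] S) := by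
      apply tendsto_nhdsWithin_of_tendsto_nhds_of_eventually_within
      · have : Tendsto (fun s : ℝ => s * S) (𝓝 1) (𝓝 (1 * S)) :=
          (continuous_id.mul continuous_const).tendsto 1
        rw [one_mul] at this
        exact this.mono_left nhdsWithin_le_nhds
      · filter_upwards [self_mem_nhdsWithin] with s hs
        have hs' : s < 1 := hs
        show s * S < S
        nlinarith
    refine hasy S ⟨fun s => (γ (s * S)).1, ?_, fun s _ => (γ (s * S)).2.1, fun K hKD hK => ?_, ?_⟩
    · refine continuous_subtype_val.comp_continuousOn (hγc.comp
        (continuous_id.mul continuous_const).continuousOn ?_)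
      intro s hs
      show s * S < S
      nlinarith [hs.2]
    · have := hcon K hKD hK
      exact hre.eventually this
    · exact hβlim.comp hre
  -- A cluster point of `γ` lies over `β S`, hence is regular, and a local inverse of `f` near it
  -- continues the lift past `S`.
  obtain ⟨z, hzK, hz⟩ := hK.exists_mapClusterPt_of_frequently hKf
  have hzD : z ∈ D := hKD hzK
  have hfz : f z = β S := by
    have h1 : MapClusterPt (f z) (𝓝[<] S) (f ∘ fun t => (γ t).1) :=
      hz.continuousAt_comp (hf.continuousOn.continuousAt (hD.mem_nhds hzD))
    have h2 : ClusterPt (f z) (𝓝 (β S)) := h1.clusterPt.mono hβlim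
    exact eq_of_nhds_neBot h2
  have hz' : deriv f z ≠ 0 := IsCriticalValue.regular hzD hfz (hcrit S)
  obtain ⟨φ, hφz, hφ⟩ := isLocalHomeomorph_regularMap hD hf ⟨z, hzD, hz'⟩
  have hzcl : MapClusterPt (⟨z, hzD, hz'⟩ : RegularPoints D f) (𝓝[<] S) γ :=
    Topology.IsInducing.subtypeVal.mapClusterPt_iff.1 hz
  have hfreq := mapClusterPt_iff_frequently.1 hzcl _ (φ.open_source.mem_nhds hφz)
  have htar : β S ∈ φ.target := by
    have := φ.map_source hφz
    rw [← hφ] at this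
    rwa [← hfz]
  obtain ⟨ε, hε, hball⟩ := Metric.isOpen_iff.1 (φ.open_target.preimage hβ) S htar
  have hev : ∀ᶠ t in 𝓝[<] S, max 0 (S - ε) < t ∧ t < S := by
    filter_upwards [self_mem_nhdsWithin, mem_nhdsWithin_of_mem_nhds
      (Ioi_mem_nhds (show max 0 (S - ε) < S from max_lt hS (by linarith)))] with t ht1 ht2
    exact ⟨ht2, ht1⟩
  obtain ⟨t₁, ht₁s, ht₁, ht₁S⟩ := (hfreq.and_eventually hev).exists
  have ht₁0 : 0 < t₁ := (le_max_left _ _).trans_lt ht₁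
  have ht₁ε : S - ε < t₁ := (le_max_right _ _).trans_lt ht₁
  set T := S + ε / 2 with hT
  have hmem : ∀ t, β (max t₁ (min t T)) ∈ φ.target := by
    intro t
    apply hball
    rw [Metric.mem_ball, Real.dist_eq, abs_lt]
    constructor
    · have := le_max_left t₁ (min t T); linarith
    · have : max t₁ (min t T) ≤ T := max_le (by rw [hT]; linarith) (min_le_right _ _)
      linarith
  refine ⟨T, by rw [hT]; linarith, fun t => if t ≤ t₁ then γ (min t t₁) else
    φ.symm (β (max t₁ (min t T))), ?_, ?_, ?_⟩
  · refine Continuous.if_le ?_ ?_ continuous_id continuous_const ?_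
    · exact hγc.comp_continuous (by fun_prop) (fun t => (min_le_right _ _).trans_lt ht₁S)
    · exact φ.continuousOn_symm.comp_continuous (by fun_prop) hmem
    · rintro t (rfl : t = t₁)
      have : t ≤ T := by rw [hT]; linarith
      rw [min_self, min_eq_left this, max_self, ← hγβ t ht₁S, hφ, φ.left_inv ht₁s]
  · obtain ⟨h1, h2, h3⟩ := hm1 0 hS
    simp only [ht₁0.le, if_true, min_eq_left]
    exact hΓ0 _ h1 h2
  · intro t ht
    by_cases h : t ≤ t₁
    · simp only [h, if_true, min_eq_left]
      exact hγβ t (h.trans_lt ht₁S)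
    · have h1 := hmem t
      simp only [h, if_false]
      rw [min_eq_left ht, max_eq_right (not_le.1 h).le] at h1 ⊢
      rw [hφ, φ.right_inv h1]

/-- The initial rest of `β` makes time `1` admissible, so a finite supremum of admissible times
would be positive and `partial_lift_extend` would go beyond it. -/
theorem exists_lift_of_const (hD : IsOpen D) (hf : DifferentiableOn ℂ f D) {β : ℝ → ℂ}
    (hβ : Continuous β) (hcrit : ∀ t, ¬ IsCriticalValue D f (β t))
    (hasy : ∀ t, ¬ IsAsymptoticValue D f (β t)) (hconst : ∀ t ≤ 1, β t = β 0)
    {e : RegularPoints D f} (he : regularMap D f e = β 0) (S : ℝ) :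
    ∃ γ : ℝ → RegularPoints D f, Continuous γ ∧ γ 0 = e ∧
      ∀ t ≤ S, regularMap D f (γ t) = β t := by
  set A : Set ℝ := {T | ∃ γ : ℝ → RegularPoints D f, Continuous γ ∧ γ 0 = e ∧
      ∀ t ≤ T, regularMap D f (γ t) = β t} with hA
  have h1 : (1 : ℝ) ∈ A := ⟨fun _ => e, continuous_const, rfl, fun t ht => by rw [he, hconst t ht]⟩
  by_contra hS
  have hdown : ∀ T ∈ A, ∀ T' ≤ T, T' ∈ A := by
    rintro T ⟨γ, h1, h2, h3⟩ T' hT'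
    exact ⟨γ, h1, h2, fun t ht => h3 t (ht.trans hT')⟩
  have hbdd : BddAbove A := ⟨S, fun T hT => by
    by_contra! h
    exact hS (hdown T hT S h.le)⟩
  obtain ⟨T, hT, hTA⟩ := partial_lift_extend hD hf hβ hcrit hasy (e := e) (S := sSup A)
    (zero_lt_one.trans_le (le_csSup hbdd h1)) (fun T _ hT => by
      obtain ⟨T', hT', h⟩ := exists_lt_of_lt_csSup ⟨1, h1⟩ hT
      exact hdown T' hT' T h.le)
  exact absurd (le_csSup hbdd hTA) (not_le.2 hT)

open Metric unitInterval in
/-- A holomorphic function on the unit disc which omits the critical values and the asymptotic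
values of `f` lifts through `f`. -/
theorem exists_disc_lift (hD : IsOpen D) (hf : DifferentiableOn ℂ f D) {g : ℂ → ℂ}
    (hg : DifferentiableOn ℂ g (ball 0 1))
    (hcrit : ∀ z ∈ ball (0 : ℂ) 1, ¬ IsCriticalValue D f (g z))
    (hasy : ∀ z ∈ ball (0 : ℂ) 1, ¬ IsAsymptoticValue D f (g z)) {p : ℂ} (hp : p ∈ D)
    (hfp : f p = g 0) :
    ∃ h : ℂ → ℂ, DifferentiableOn ℂ h (ball 0 1) ∧ h 0 = p ∧
      ∀ z ∈ ball (0 : ℂ) 1, h z ∈ D ∧ f (h z) = g z := by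
  have h0 : (0 : ℂ) ∈ ball (0 : ℂ) 1 := by simp
  have hp' : deriv f p ≠ 0 := IsCriticalValue.regular hp hfp (hcrit 0 h0)
  set e : RegularPoints D f := ⟨p, hp, hp'⟩ with he
  have hmem : ∀ (z : ball (0 : ℂ) 1) (t : I), ((t : ℝ) : ℂ) * z ∈ ball (0 : ℂ) 1 := by
    intro z t
    have hz : ‖(z : ℂ)‖ < 1 := mem_ball_zero_iff.1 z.2
    rw [mem_ball_zero_iff, norm_mul, Complex.norm_real, Real.norm_of_nonneg t.2.1]
    exact (mul_le_of_le_one_left (norm_nonneg _) t.2.2).trans_lt hz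
  have hpath : ∀ z : ball (0 : ℂ) 1, ∃ Γ : I → RegularPoints D f, Continuous Γ ∧ Γ 0 = e ∧
      ∀ t, regularMap D f (Γ t) = g (((t : ℝ) : ℂ) * z) := by
    intro z
    -- The path rests at `g 0` until time `1` and runs along the segment from `0` to `z` during `[1,
    -- 2]`.
    obtain ⟨γ, hγ, hγ0, hγβ⟩ := exists_lift_of_const hD hf
      (β := fun t => g (((projIcc (0 : ℝ) 1 zero_le_one (t - 1) : I) : ℝ) * z)) (e := e)
      (hg.continuousOn.comp_continuous (by fun_prop) (fun t => hmem z _))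
      (fun t => hcrit _ (hmem z _)) (fun t => hasy _ (hmem z _))
      (fun t ht => by
        rw [projIcc_of_le_left _ (by linarith), projIcc_of_le_left _ (by linarith)])
      (by rw [projIcc_of_le_left _ (by linarith)]; simp [he, regularMap, hfp]) 2
    have huniq := (T2Space.isSeparatedMap (regularMap D f)).eqOn_of_comp_eqOn
      (isLocalHomeomorph_regularMap hD hf).isLocallyInjective (s := Iic (1 : ℝ)) (g₁ := γ)
      (g₂ := fun _ => e) isPreconnected_Iic hγ.continuousOn continuousOn_const (fun t ht => by
        have ht' : t ≤ 1 := ht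
        simp only [Function.comp_apply]
        rw [hγβ t (by linarith), projIcc_of_le_left _ (by linarith)]
        simp [he, regularMap, hfp]) (a := 0) (by simp) hγ0
    refine ⟨fun t => γ (t + 1), by fun_prop, ?_, fun t => ?_⟩
    · have := huniq (show (1 : ℝ) ∈ Iic 1 by simp)
      simpa using this
    · rw [hγβ _ (by have := t.2.2; linarith), add_sub_cancel_right, projIcc_val]
  choose Γ hΓc hΓ0 hΓ using hpath
  -- Lifts along the rays with a common starting point are jointly continuous in `(t, z)`; their
  -- values at time `1` form `h`.
  have hcont := (isLocalHomeomorph_regularMap hD hf).continuous_lift (T2Space.isSeparatedMap _)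
    (A := ball (0 : ℂ) 1)
    ⟨fun x : I × ball (0 : ℂ) 1 => g (((x.1 : ℝ) : ℂ) * x.2),
      hg.continuousOn.comp_continuous (by fun_prop) (fun x => hmem x.2 x.1)⟩
    (g := fun x => Γ x.2 x.1) (by ext x; exact hΓ _ _) (by simp only [hΓ0]; exact continuous_const)
    hΓc
  classical
  set h : ℂ → ℂ := fun z => if hz : z ∈ ball (0 : ℂ) 1 then (Γ ⟨z, hz⟩ 1).1 else 0 with hh
  have hval : ∀ z (hz : z ∈ ball (0 : ℂ) 1), h z = (Γ ⟨z, hz⟩ 1).1 := by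
    intro z hz
    simp only [hh, dif_pos hz]
  have hfh : ∀ z ∈ ball (0 : ℂ) 1, h z ∈ D ∧ f (h z) = g z := by
    intro z hz
    rw [hval z hz]
    refine ⟨(Γ ⟨z, hz⟩ 1).2.1, ?_⟩
    have := hΓ ⟨z, hz⟩ 1
    simpa [regularMap] using this
  have hhc : ContinuousOn h (ball 0 1) := by
    rw [continuousOn_iff_continuous_domRestrict]
    have : (ball (0 : ℂ) 1).domRestrict h = fun z => (Γ z 1).1 := by
      ext z
      exact hval z.1 z.2
    rw [this]
    exact continuous_subtype_val.comp (hcont.comp (by fun_prop : Continuous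
      (fun z : ball (0 : ℂ) 1 => ((1 : I), z))))
  refine ⟨h, fun z hz => ?_, ?_, hfh⟩
  · obtain ⟨hzD, hfz⟩ := hfh z hz
    obtain ⟨ψ, hψ, hψ'⟩ := exists_local_left_inverse hD hf hzD
      (IsCriticalValue.regular hzD hfz (hcrit z hz))
    rw [hfz] at hψ
    have hgd := hg.differentiableAt (isOpen_ball.mem_nhds hz)
    have hd : DifferentiableAt ℂ (ψ ∘ g) z :=
      hψ.hasDerivAt.differentiableAt.comp z hgd
    refine (hd.congr_of_eventuallyEq ?_).differentiableWithinAt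
    filter_upwards [(hhc.continuousAt (isOpen_ball.mem_nhds hz)).eventually hψ',
      isOpen_ball.mem_nhds hz] with w hw hw'
    rw [Function.comp_apply, ← (hfh w hw').2, hw]
  · rw [hval 0 h0]
    have := (T2Space.isSeparatedMap (regularMap D f)).eq_of_comp_eq
      (isLocalHomeomorph_regularMap hD hf).isLocallyInjective (A := I)
      (g₁ := Γ ⟨0, h0⟩) (g₂ := fun _ => e) (hΓc _) continuous_const (by
        ext t
        simp only [Function.comp_apply]
        rw [hΓ]
        simp [he, regularMap, hfp]) 0 (hΓ0 _)
    rw [this]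

open Metric in
/-- Two lifts through `f` of the same function coincide if they coincide at one point. -/
theorem disc_lift_unique (hD : IsOpen D) (hf : DifferentiableOn ℂ f D) {h₁ h₂ : ℂ → ℂ}
    (hh₁ : DifferentiableOn ℂ h₁ (ball 0 1)) (hh₂ : DifferentiableOn ℂ h₂ (ball 0 1))
    {w : ℂ} (hw : w ∈ ball (0 : ℂ) 1) (hwD : h₁ w ∈ D)
    (hcrit : ¬ IsCriticalValue D f (f (h₁ w)))
    (hfeq : ∀ z ∈ ball (0 : ℂ) 1, f (h₁ z) = f (h₂ z)) (heq : h₁ w = h₂ w) :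
    EqOn h₁ h₂ (ball 0 1) := by
  have hnhds : ball (0 : ℂ) 1 ∈ 𝓝 w := isOpen_ball.mem_nhds hw
  obtain ⟨ψ, -, hψ⟩ := exists_local_left_inverse hD hf hwD (IsCriticalValue.regular hwD rfl hcrit)
  refine (hh₁.analyticOnNhd isOpen_ball).eqOn_of_preconnected_of_eventuallyEq
    (hh₂.analyticOnNhd isOpen_ball) (convex_ball _ _).isPreconnected hw ?_
  have hψ2 := hψ
  rw [heq] at hψ2
  filter_upwards [(hh₁.continuousOn.continuousAt hnhds).eventually hψ,
    (hh₂.continuousOn.continuousAt hnhds).eventually hψ2, hnhds] with z h1 h2 hz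
  rw [← h1, ← h2, hfeq z hz]

end Regular

/-! ### Holomorphic motions of the critical orbit and their lifts. -/

section Motions

/-- The index of the image of the `i`-th point of an orbit `p 0, …, p (q - 1)` whose last point is
mapped to `p l`. -/
def nextIndex (q l i : ℕ) : ℕ := if i + 1 = q then l else i + 1

theorem nextIndex_lt {q l i : ℕ} (hl : l < q) (hi : i < q) : nextIndex q l i < q := by
  unfold nextIndex; split_ifs <;> omega

/-- Only the turning point is sent to `p 1`; this keeps the other lifted values off the critical
value `1`. -/
theorem nextIndex_ne_one {q l i : ℕ} (hl : l ≠ 1) (hi : i ≠ 0) : nextIndex q l i ≠ 1 := by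
  unfold nextIndex; split_ifs <;> omega

/-- A finite critical orbit `p 0, …, p (q - 1)` of the map `p 1 * f`, whose last point is mapped to
`p l`. The proposition `O` tells whether `f` is odd (with critical values `0, 1, -1`) or not (with
critical values `0, 1`). -/
structure FiniteCriticalOrbit (D : Set ℂ) (f : ℂ → ℂ) (O : Prop) (p : ℕ → ℂ) (q l : ℕ) : Prop where
  isOpen : IsOpen D
  holo : DifferentiableOn ℂ f D
  asymptotic : ∀ v : ℂ, IsAsymptoticValue D f v → v = 0
  map_zero : f 0 = 0
  odd : O → ∀ z ∈ D, f (-z) = -f z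
  critical : ∀ v : ℂ, IsCriticalValue D f v → v = 0 ∨ v = 1 ∨ (O ∧ v = -1)
  two_le : 2 ≤ q
  lt : l < q
  ne_one : l ≠ 1
  mem : ∀ i < q, p i ∈ D
  map : ∀ i < q, f (p i) = p (nextIndex q l i) / p 1
  deriv_ne_zero : ∀ i < q, i ≠ 0 → deriv f (p i) ≠ 0

open Metric in
/-- A holomorphic motion of the points `p 0, …, p (q - 1)` over the unit disc, which fixes `0` and
`p 0`, and is symmetric if `O` holds. -/
structure IsMotion (O : Prop) (p : ℕ → ℂ) (q : ℕ) (h : ℕ → ℂ → ℂ) : Prop where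
  holo : ∀ i < q, DifferentiableOn ℂ (h i) (ball 0 1)
  base : ∀ i < q, h i 0 = p i
  fix : ∀ z ∈ ball (0 : ℂ) 1, h 0 z = p 0
  ne_zero : ∀ i < q, ∀ z ∈ ball (0 : ℂ) 1, h i z ≠ 0
  inj : ∀ i < q, ∀ j < q, i ≠ j → ∀ z ∈ ball (0 : ℂ) 1, h i z ≠ h j z
  odd : O → ∀ i < q, ∀ j < q, ∀ z ∈ ball (0 : ℂ) 1, h i z ≠ -h j z

open Metric in
/-- `h'` is a lift of the motion `h`. -/
def IsMotionLift (D : Set ℂ) (f : ℂ → ℂ) (q l : ℕ) (h h' : ℕ → ℂ → ℂ) : Prop :=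
  ∀ i < q, ∀ z ∈ ball (0 : ℂ) 1, h' i z ∈ D ∧ f (h' i z) = h (nextIndex q l i) z / h 1 z

variable {D : Set ℂ} {f : ℂ → ℂ} {O : Prop} {p : ℕ → ℂ} {q l : ℕ}

open Metric in
/-- The lifting property. -/
theorem FiniteCriticalOrbit.exists_motionLift (hP : FiniteCriticalOrbit D f O p q l)
    {h : ℕ → ℂ → ℂ} (hh : IsMotion O p q h) :
    ∃ h', IsMotion O p q h' ∧ IsMotionLift D f q l h h' := by
  have h0 : (0 : ℂ) ∈ ball (0 : ℂ) 1 := by simp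
  have h1q : 1 < q := hP.two_le
  have hnext : ∀ i < q, nextIndex q l i < q := fun i hi => nextIndex_lt hP.lt hi
  have hg0 : ∀ i < q, ∀ z ∈ ball (0 : ℂ) 1, h (nextIndex q l i) z / h 1 z ≠ 0 := fun i hi z hz =>
    div_ne_zero (hh.ne_zero _ (hnext i hi) z hz) (hh.ne_zero 1 h1q z hz)
  have hg1 : ∀ i < q, i ≠ 0 → ∀ z ∈ ball (0 : ℂ) 1, h (nextIndex q l i) z / h 1 z ≠ 1 := by
    intro i hi hi0 z hz h1
    rw [div_eq_one_iff_eq (hh.ne_zero 1 h1q z hz)] at h1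
    exact hh.inj _ (hnext i hi) 1 h1q (nextIndex_ne_one hP.ne_one hi0) z hz h1
  have hcrit : ∀ i < q, i ≠ 0 → ∀ z ∈ ball (0 : ℂ) 1,
      ¬ IsCriticalValue D f (h (nextIndex q l i) z / h 1 z) := by
    intro i hi hi0 z hz hc
    rcases hP.critical _ hc with h1 | h1 | ⟨hO, h1⟩
    · exact hg0 i hi z hz h1
    · exact hg1 i hi hi0 z hz h1
    · rw [div_eq_iff (hh.ne_zero 1 h1q z hz), neg_one_mul] at h1
      exact hh.odd hO _ (hnext i hi) 1 h1q z hz h1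
  have hex : ∀ i : ℕ, ∃ H : ℂ → ℂ, i < q → DifferentiableOn ℂ H (ball 0 1) ∧ H 0 = p i ∧
      (∀ z ∈ ball (0 : ℂ) 1, H z ∈ D ∧ f (H z) = h (nextIndex q l i) z / h 1 z) ∧
      (i = 0 → ∀ z, H z = p 0) := by
    intro i
    by_cases hi : i < q
    · by_cases hi0 : i = 0
      · subst hi0
        -- Index `0` lies over the value `1`, taken at the turning point, where local inversion is
        -- not available; the constant motion is a lift.
        have hn : nextIndex q l 0 = 1 := by unfold nextIndex; rw [if_neg (by omega)]
        refine ⟨fun _ => p 0, fun _ => ⟨differentiableOn_const _, rfl, fun z hz =>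
          ⟨hP.mem 0 hi, ?_⟩, fun _ _ => rfl⟩⟩
        have hp1 : p 1 ≠ 0 := by rw [← hh.base 1 h1q]; exact hh.ne_zero 1 h1q 0 h0
        rw [hP.map 0 hi, hn, div_self (hh.ne_zero 1 h1q z hz), div_self hp1]
      · obtain ⟨H, hH, hH0, hHf⟩ := exists_disc_lift hP.isOpen hP.holo
          (g := fun z => h (nextIndex q l i) z / h 1 z)
          ((hh.holo _ (hnext i hi)).div (hh.holo 1 h1q) (hh.ne_zero 1 h1q)) (hcrit i hi hi0)
          (fun z hz ha => hg0 i hi z hz (hP.asymptotic _ ha)) (hP.mem i hi) (by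
            rw [hP.map i hi, hh.base _ (hnext i hi), hh.base 1 h1q])
        exact ⟨H, fun _ => ⟨hH, hH0, hHf, fun h => absurd h hi0⟩⟩
    · exact ⟨fun _ => 0, fun h => absurd h hi⟩
  choose H hH using hex
  -- Two lifts that collide have the same image motion, so they are lifts of one function through a
  -- regular point and coincide on the disc, contradicting distinct base points.
  have hne : ∀ i < q, ∀ j < q, i ≠ j → j ≠ 0 → ∀ z ∈ ball (0 : ℂ) 1, H i z ≠ H j z := by
    intro i hi j hj hij hj0 z hz heq
    obtain ⟨hdi, hbi, hli, hci⟩ := hH i hi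
    obtain ⟨hdj, hbj, hlj, hcj⟩ := hH j hj
    have h1 : h (nextIndex q l i) z / h 1 z = h (nextIndex q l j) z / h 1 z := by
      rw [← (hli z hz).2, ← (hlj z hz).2, heq]
    have h2 : nextIndex q l i = nextIndex q l j := by
      by_contra hn
      exact hh.inj _ (hnext i hi) _ (hnext j hj) hn z hz
        ((div_left_inj' (hh.ne_zero 1 h1q z hz)).1 h1)
    have h3 := disc_lift_unique hP.isOpen hP.holo hdj hdi hz (hlj z hz).1
      (by rw [(hlj z hz).2]; exact hcrit j hj hj0 z hz)
      (fun w hw => by rw [(hli w hw).2, (hlj w hw).2, h2]) heq.symm h0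
    have h4 : h i 0 = h j 0 := by rw [hh.base i hi, hh.base j hj, ← hbi, ← hbj, h3]
    exact hh.inj i hi j hj hij 0 h0 h4
  refine ⟨H, ⟨fun i hi => (hH i hi).1, fun i hi => (hH i hi).2.1,
    fun z _ => (hH 0 (by omega)).2.2.2 rfl z, fun i hi z hz hz0 => ?_, fun i hi j hj hij z hz => ?_,
    fun hO i hi j hj z hz heq => ?_⟩, fun i hi z hz => (hH i hi).2.2.1 z hz⟩
  · have h1 := ((hH i hi).2.2.1 z hz).2
    rw [hz0, hP.map_zero] at h1
    exact hg0 i hi z hz h1.symm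
  · by_cases hj0 : j = 0
    · exact (hne j hj i hi (Ne.symm hij) (by omega) z hz).symm
    · exact hne i hi j hj hij hj0 z hz
  · have h1 := ((hH i hi).2.2.1 z hz).2
    obtain ⟨hDj, h2⟩ := (hH j hj).2.2.1 z hz
    rw [heq, hP.odd hO _ hDj, h2, ← neg_div, div_left_inj' (hh.ne_zero 1 h1q z hz)] at h1
    exact hh.odd hO _ (hnext i hi) _ (hnext j hj) z hz h1.symm

/-- The sequence of successive lifts of a motion. -/
theorem FiniteCriticalOrbit.exists_motionLift_seq (hP : FiniteCriticalOrbit D f O p q l)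
    {h : ℕ → ℂ → ℂ} (hh : IsMotion O p q h) :
    ∃ H : ℕ → ℕ → ℂ → ℂ, H 0 = h ∧ (∀ k, IsMotion O p q (H k)) ∧
      ∀ k, IsMotionLift D f q l (H k) (H (k + 1)) := by
  choose! L hL hL' using fun h (hh : IsMotion O p q h) => hP.exists_motionLift hh
  have hm : ∀ k, IsMotion O p q (L^[k] h) := by
    intro k
    induction k with
    | zero => exact hh
    | succ k ih => rw [Function.iterate_succ_apply']; exact hL _ ih
  refine ⟨fun k => L^[k] h, rfl, hm, fun k => ?_⟩
  show IsMotionLift D f q l (L^[k] h) (L^[k + 1] h)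
  rw [Function.iterate_succ_apply']
  exact hL' _ (hm k)

open Metric in
/-- Motions of a given set of points are uniformly bounded. -/
theorem exists_motion_bound (O : Prop) (p : ℕ → ℂ) {q : ℕ} (hq : 0 < q) :
    ∃ C : ℝ, ∀ h, IsMotion O p q h → ∀ i < q, ∀ z ∈ ball (0 : ℂ) (1 / 2), ‖h i z‖ ≤ C := by
  -- `h i / p 0` omits `0` and `1`, since the motion avoids `0` and the fixed point `p 0`.
  choose C hC using fun i => schottky (p i / p 0)
  refine ⟨∑ i ∈ Finset.range q, |C i * ‖p 0‖| + ‖p 0‖, fun h hh i hi z hz => ?_⟩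
  have hsub : ball (0 : ℂ) (1 / 2) ⊆ ball (0 : ℂ) 1 := ball_subset_ball (by norm_num)
  have h0 : (0 : ℂ) ∈ ball (0 : ℂ) 1 := by simp
  have hp0 : p 0 ≠ 0 := by rw [← hh.base 0 hq]; exact hh.ne_zero 0 hq 0 h0
  have hsum : |C i * ‖p 0‖| ≤ ∑ i ∈ Finset.range q, |C i * ‖p 0‖| :=
    Finset.single_le_sum (f := fun i => |C i * ‖p 0‖|) (fun _ _ => abs_nonneg _)
      (Finset.mem_range.2 hi)
  by_cases hi0 : i = 0
  · rw [hi0, hh.fix z (hsub hz)]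
    have : 0 ≤ ∑ i ∈ Finset.range q, |C i * ‖p 0‖| := Finset.sum_nonneg fun _ _ => abs_nonneg _
    linarith
  · have := hC i (fun z => h i z / p 0) ((hh.holo i hi).div_const _) (by simp only [hh.base i hi])
      (fun w hw => ⟨div_ne_zero (hh.ne_zero i hi w hw) hp0, fun h1 => by
        rw [div_eq_one_iff_eq hp0, ← hh.fix w hw] at h1
        exact hh.inj i hi 0 hq hi0 w hw h1⟩) z hz
    rw [norm_div, div_le_iff₀ (norm_pos_iff.2 hp0)] at this
    have := le_abs_self (C i * ‖p 0‖)
    linarith [norm_nonneg (p 0)]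

end Motions

/-! ### Taylor coefficients of iterated lifts. -/

section TaylorCoefficients

/-- `g z = t * z ^ m + o(z ^ m)` as `z → 0`. -/
def IsCoeff (m : ℕ) (g : ℂ → ℂ) (t : ℂ) : Prop :=
  (fun z => g z - t * z ^ m) =o[𝓝 0] (fun z : ℂ => z ^ m)

section Coeff

variable {m : ℕ} {g g₁ g₂ : ℂ → ℂ} {t t₁ t₂ : ℂ}

theorem IsCoeff.congr (h : IsCoeff m g₁ t₁) (hg : g₁ =ᶠ[𝓝 0] g₂) (ht : t₁ = t₂) :
    IsCoeff m g₂ t₂ := by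
  subst ht
  refine Asymptotics.IsLittleO.congr' h ?_ EventuallyEq.rfl
  filter_upwards [hg] with z hz
  rw [hz]

theorem IsCoeff.sub (h₁ : IsCoeff m g₁ t₁) (h₂ : IsCoeff m g₂ t₂) :
    IsCoeff m (fun z => g₁ z - g₂ z) (t₁ - t₂) := by
  refine (Asymptotics.IsLittleO.sub h₁ h₂).congr_left fun z => ?_
  ring

theorem IsCoeff.isBigO (h : IsCoeff m g t) : g =O[𝓝 0] (fun z : ℂ => z ^ m) := by
  have h1 := (Asymptotics.IsLittleO.isBigO h).add
    ((Asymptotics.isBigO_refl (fun z : ℂ => z ^ m) (𝓝 0)).const_mul_left t)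
  simpa using h1

theorem IsCoeff.mul_tendsto (h : IsCoeff m g t) {φ : ℂ → ℂ} {b : ℂ} (hφ : Tendsto φ (𝓝 0) (𝓝 b)) :
    IsCoeff m (fun z => φ z * g z) (b * t) := by
  have h1 : (fun z => φ z * (g z - t * z ^ m)) =o[𝓝 0] (fun z : ℂ => 1 * z ^ m) :=
    (hφ.isBigO_one ℂ).mul_isLittleO h
  have h2 : (fun z => (φ z - b) * (t * z ^ m)) =o[𝓝 0] (fun z : ℂ => 1 * z ^ m) := by
    refine Asymptotics.IsLittleO.mul_isBigO ?_
      ((Asymptotics.isBigO_refl (fun z : ℂ => z ^ m) (𝓝 0)).const_mul_left t)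
    rw [Asymptotics.isLittleO_one_iff]
    simpa using hφ.sub_const b
  simp only [one_mul] at h1 h2
  refine (h1.add h2).congr_left fun z => ?_
  ring

/-- Taylor coefficients of lifts through a locally invertible function. -/
theorem IsCoeff.of_comp {f u v : ℂ → ℂ} {p f' s : ℂ} (hf : HasStrictDerivAt f f' p) (hf' : f' ≠ 0)
    (hu : Tendsto u (𝓝 0) (𝓝 p)) (hv : Tendsto v (𝓝 0) (𝓝 p))
    (h : IsCoeff m (fun z => f (u z) - f (v z)) s) : IsCoeff m (fun z => u z - v z) (f'⁻¹ * s) := by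
  have hψ := hf.to_localInverse hf'
  have hl := hf.eventually_left_inverse hf'
  set ψ := hf.localInverse f f' p hf'
  have hfp := hf.hasDerivAt.continuousAt.tendsto
  have huv : Tendsto (fun z => (f (u z), f (v z))) (𝓝 0) (𝓝 (f p, f p)) := by
    rw [nhds_prod_eq]
    exact (hfp.comp hu).prodMk (hfp.comp hv)
  have h1 := (hψ.isLittleO.comp_tendsto huv).trans_isBigO h.isBigO
  have h2 : (fun z => f'⁻¹ * (f (u z) - f (v z) - s * z ^ m)) =o[𝓝 0] (fun z : ℂ => z ^ m) :=
    Asymptotics.IsLittleO.const_mul_left h _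
  refine (h1.add h2).congr' ?_ EventuallyEq.rfl
  filter_upwards [hu.eventually hl, hv.eventually hl] with z hz1 hz2
  simp only [Function.comp_apply, hz1, hz2, ContinuousLinearMap.toSpanSingleton_apply, smul_eq_mul]
  ring

open Metric in
/-- Cauchy's estimate for the first nonzero coefficient. -/
theorem IsCoeff.norm_le (hm : m ≠ 0) {C : ℝ} (hg : DifferentiableOn ℂ g (ball 0 (1 / 2)))
    (hC : ∀ z ∈ ball (0 : ℂ) (1 / 2), ‖g z‖ ≤ C) (h : IsCoeff m g t) : ‖t‖ ≤ C * 2 ^ m := by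
  obtain ⟨n, rfl⟩ := Nat.exists_eq_succ_of_ne_zero hm
  have hb : (0 : ℂ) ∈ ball (0 : ℂ) (1 / 2) := by simp
  have hg0 : g 0 = 0 := by
    have := h.isBigO.eq_zero_imp.self_of_nhds
    simpa using this
  -- A zero of order `n + 1` allows the higher-order Schwarz lemma on the disc of radius `1 / 2`.
  have hO : (fun z => g z - g 0) =o[𝓝 0] (fun z : ℂ => ‖z - 0‖ ^ n) := by
    simp only [hg0, sub_zero]
    refine h.isBigO.trans_isLittleO ?_
    refine (Asymptotics.isLittleO_pow_pow (𝕜 := ℂ) (Nat.lt_succ_self n)).trans_isBigO ?_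
    simp only [← norm_pow]
    exact (Asymptotics.isBigO_refl (fun z : ℂ => z ^ n) (𝓝 0)).norm_right
  have hle : ∀ z ∈ ball (0 : ℂ) (1 / 2), ‖g z‖ ≤ C * 2 ^ (n + 1) * ‖z‖ ^ (n + 1) := by
    intro z hz
    have := Complex.dist_le_mul_div_pow_of_mapsTo_ball_of_isLittleO (f := g) (R₂ := C) hg
      (fun w hw => by rw [hg0, mem_closedBall_zero_iff]; exact hC w hw) hO hz
    rw [hg0, dist_zero_right, dist_zero_right] at this
    refine this.trans_eq ?_
    rw [div_pow, one_div, inv_pow, div_inv_eq_mul]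
    ring
  have hlim : Tendsto (fun z : ℂ => g z / z ^ (n + 1)) (𝓝[≠] 0) (𝓝 t) := by
    have h1 := (Asymptotics.IsLittleO.tendsto_div_nhds_zero h).mono_left
      (nhdsWithin_le_nhds (s := {0}ᶜ))
    have h2 := h1.add_const t
    rw [zero_add] at h2
    refine h2.congr' ?_
    filter_upwards [self_mem_nhdsWithin] with z hz
    have : z ≠ 0 := hz
    field_simp
    ring
  refine le_of_tendsto hlim.norm ?_
  filter_upwards [self_mem_nhdsWithin, mem_nhdsWithin_of_mem_nhds (isOpen_ball.mem_nhds hb)]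
    with z hz hz'
  have hz0 : z ≠ 0 := hz
  rw [norm_div, norm_pow, div_le_iff₀ (by positivity)]
  exact hle z hz'

end Coeff

variable {D : Set ℂ} {f : ℂ → ℂ} {O : Prop} {p : ℕ → ℂ} {q l : ℕ}

open Metric in
theorem IsMotion.tendsto {h : ℕ → ℂ → ℂ} (hh : IsMotion O p q h) {i : ℕ} (hi : i < q) :
    Tendsto (h i) (𝓝 0) (𝓝 (p i)) := by
  have := ((hh.holo i hi).continuousOn.continuousAt
    (isOpen_ball.mem_nhds (show (0 : ℂ) ∈ ball (0 : ℂ) 1 by simp))).tendsto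
  rwa [hh.base i hi] at this

open Metric in
/-- The recursion for the Taylor coefficients of successive lifts, relative to a motion `γ` which
is almost invariant. -/
theorem IsMotionLift.isCoeff (hP : FiniteCriticalOrbit D f O p q l) {h h' γ : ℕ → ℂ → ℂ}
    (hh : IsMotion O p q h) (hh' : IsMotion O p q h') (hγ : IsMotion O p q γ)
    (hl : IsMotionLift D f q l h h') {m : ℕ} {r t : ℕ → ℂ} {i : ℕ} (hi : i < q) (hi0 : i ≠ 0)
    (hr : IsCoeff m (fun z => f (γ i z) * γ 1 z - γ (nextIndex q l i) z) (r i))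
    (ht : ∀ i < q, IsCoeff m (fun z => h i z - γ i z) (t i)) :
    IsCoeff m (fun z => h' i z - γ i z) ((deriv f (p i))⁻¹ *
      ((p 1)⁻¹ * (t (nextIndex q l i) - r i - f (p i) * t 1))) := by
  have h1q : 1 < q := hP.two_le
  have hn := nextIndex_lt hP.lt hi
  have h0 : (0 : ℂ) ∈ ball (0 : ℂ) 1 := by simp
  have hp1 : p 1 ≠ 0 := by rw [← hh.base 1 h1q]; exact hh.ne_zero 1 h1q 0 h0
  have hst := hasStrictDerivAt_of_mem hP.isOpen hP.holo (hP.mem i hi)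
  refine IsCoeff.of_comp hst (hP.deriv_ne_zero i hi hi0) (hh'.tendsto hi) (hγ.tendsto hi) ?_
  have hfγ : Tendsto (fun z => f (γ i z)) (𝓝 0) (𝓝 (f (p i))) :=
    hst.hasDerivAt.continuousAt.tendsto.comp (hγ.tendsto hi)
  -- With `j` the next index, `h_j / h_1 - f(γ_i) = h_1⁻¹ ((h_j - γ_j) - (f(γ_i) γ_1 - γ_j) - f(γ_i)
  -- (h_1 - γ_1))`.
  have h1 := (((ht _ hn).sub hr).sub ((ht 1 h1q).mul_tendsto hfγ)).mul_tendsto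
    ((hh.tendsto h1q).inv₀ hp1)
  refine h1.congr ?_ rfl
  filter_upwards [isOpen_ball.mem_nhds h0] with z hz
  rw [(hl i hi z hz).2]
  have := hh.ne_zero 1 h1q z hz
  field_simp
  ring

open Metric in
/-- The Taylor coefficients of successive lifts satisfy a recursion and are bounded. -/
theorem FiniteCriticalOrbit.exists_bounded_coeffs (hP : FiniteCriticalOrbit D f O p q l)
    {h γ : ℕ → ℂ → ℂ} (hh : IsMotion O p q h) (hγ : IsMotion O p q γ) {m : ℕ} (hm : m ≠ 0)
    {r t₀ : ℕ → ℂ}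
    (hr : ∀ i < q, i ≠ 0 →
      IsCoeff m (fun z => f (γ i z) * γ 1 z - γ (nextIndex q l i) z) (r i))
    (ht : ∀ i < q, IsCoeff m (fun z => h i z - γ i z) (t₀ i)) (ht0 : t₀ 0 = 0) :
    ∃ t : ℕ → ℕ → ℂ, t 0 = t₀ ∧ (∀ k, t k 0 = 0) ∧
      (∀ k, ∀ i < q, i ≠ 0 → p 1 * deriv f (p i) * t (k + 1) i =
        t k (nextIndex q l i) - r i - f (p i) * t k 1) ∧
      ∃ C : ℝ, ∀ k, ∀ i < q, ‖t k i‖ ≤ C := by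
  have h1q : 1 < q := hP.two_le
  have hp1 : p 1 ≠ 0 := by rw [← hh.base 1 h1q]; exact hh.ne_zero 1 h1q 0 (by simp)
  obtain ⟨H, hH0, hH, hHl⟩ := hP.exists_motionLift_seq hh
  set step : (ℕ → ℂ) → ℕ → ℂ := fun t i => if i = 0 then 0 else (deriv f (p i))⁻¹ *
      ((p 1)⁻¹ * (t (nextIndex q l i) - r i - f (p i) * t 1)) with hstep
  set t : ℕ → ℕ → ℂ := fun k => step^[k] t₀ with ht_def
  have hsucc : ∀ k, t (k + 1) = step (t k) := fun k => Function.iterate_succ_apply' _ _ _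
  have hcoeff : ∀ k, ∀ i < q, IsCoeff m (fun z => H k i z - γ i z) (t k i) := by
    intro k
    induction k with
    | zero => rw [hH0]; exact ht
    | succ k ih =>
      intro i hi
      rw [hsucc]
      by_cases hi0 : i = 0
      · subst hi0
        simp only [hstep, if_true]
        have hz : IsCoeff m (fun _ => (0 : ℂ)) 0 := by
          simp [IsCoeff]
        refine hz.congr ?_ rfl
        filter_upwards [isOpen_ball.mem_nhds (show (0 : ℂ) ∈ ball (0 : ℂ) 1 by simp)] with z hz
        rw [(hH (k + 1)).fix z hz, hγ.fix z hz, sub_self]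
      · simp only [hstep, if_neg hi0]
        exact (hHl k).isCoeff hP (hH k) (hH (k + 1)) hγ hi hi0 (hr i hi hi0) ih
  obtain ⟨C, hC⟩ := exists_motion_bound O p (show 0 < q by omega)
  have hsub : ball (0 : ℂ) (1 / 2) ⊆ ball (0 : ℂ) 1 := ball_subset_ball (by norm_num)
  refine ⟨t, rfl, fun k => ?_, fun k i hi hi0 => ?_, (C + C) * 2 ^ m, fun k i hi => ?_⟩
  · cases k with
    | zero => exact ht0
    | succ k => rw [hsucc]; simp [hstep]
  · have := hP.deriv_ne_zero i hi hi0
    rw [hsucc]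
    simp only [hstep, if_neg hi0]
    field_simp
  · exact (hcoeff k i hi).norm_le hm
      ((((hH k).holo i hi).mono hsub).sub ((hγ.holo i hi).mono hsub)) fun z hz =>
        (norm_sub_le _ _).trans (add_le_add (hC _ (hH k) i hi z hz) (hC _ hγ i hi z hz))

end TaylorCoefficients

/-! ### Spectral consequences of the bounds. -/

section Transversality

variable {D : Set ℂ} {f : ℂ → ℂ} {O : Prop} {p : ℕ → ℂ} {q l : ℕ}

open Metric in
/-- Small perturbations of the constant motion, rescaled to the unit disc, are motions. -/
theorem IsMotion.exists_rescale (hp : IsMotion O p q (fun i _ => p i)) {γ : ℕ → ℂ → ℂ}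
    (hγ : ∀ i < q, AnalyticAt ℂ (γ i) 0) (hγ0 : ∀ i < q, γ i 0 = p i) (hc : ∀ z, γ 0 z = p 0) :
    ∃ ε : ℂ, ε ≠ 0 ∧ IsMotion O p q (fun i z => γ i (ε * z)) := by
  have h0 : (0 : ℂ) ∈ ball (0 : ℂ) 1 := by simp
  have hcont : ∀ i < q, Tendsto (γ i) (𝓝 0) (𝓝 (p i)) := fun i hi => by
    have := (hγ i hi).continuousAt.tendsto
    rwa [hγ0 i hi] at this
  have hev : ∀ᶠ z in 𝓝 (0 : ℂ), ∀ i ∈ Finset.range q, DifferentiableAt ℂ (γ i) z ∧ γ i z ≠ 0 ∧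
      ∀ j ∈ Finset.range q, (i ≠ j → γ i z ≠ γ j z) ∧ (O → γ i z ≠ -γ j z) := by
    rw [Filter.eventually_all_finset]
    intro i hi
    have hi := Finset.mem_range.1 hi
    refine ((hγ i hi).eventually_analyticAt.mono fun z hz => hz.differentiableAt).and
      (((hcont i hi).eventually_ne (hp.ne_zero i hi 0 h0)).and ?_)
    rw [Filter.eventually_all_finset]
    intro j hj
    have hj := Finset.mem_range.1 hj
    rw [Filter.eventually_and]
    constructor
    · by_cases hij : i = j
      · exact Eventually.of_forall fun _ h => absurd hij h
      · exact (((hcont i hi).sub (hcont j hj)).eventually_ne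
          (sub_ne_zero.2 (hp.inj i hi j hj hij 0 h0))).mono fun _ h _ => sub_ne_zero.1 h
    · by_cases hO : O
      · exact (((hcont i hi).sub (hcont j hj).neg).eventually_ne
          (sub_ne_zero.2 (hp.odd hO i hi j hj 0 h0))).mono fun _ h _ => sub_ne_zero.1 h
      · exact Eventually.of_forall fun _ h => absurd h hO
  obtain ⟨ε, hε, hball⟩ := Metric.eventually_nhds_iff_ball.1 hev
  have hmem : ∀ z ∈ ball (0 : ℂ) 1, (ε : ℂ) * z ∈ ball (0 : ℂ) ε := by
    intro z hz
    have hz : ‖z‖ < 1 := mem_ball_zero_iff.1 hz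
    rw [mem_ball_zero_iff, norm_mul, Complex.norm_real, Real.norm_of_nonneg hε.le]
    nlinarith
  have hb : ∀ i < q, ∀ z ∈ ball (0 : ℂ) 1, _ := fun i hi z hz =>
    hball _ (hmem z hz) i (Finset.mem_range.2 hi)
  refine ⟨ε, by exact_mod_cast hε.ne', fun i hi z hz => ?_, fun i hi => by simp [hγ0 i hi],
    fun z _ => hc _, fun i hi z hz => (hb i hi z hz).2.1,
    fun i hi j hj hij z hz => ((hb i hi z hz).2.2 j (Finset.mem_range.2 hj)).1 hij,
    fun hO i hi j hj z hz => ((hb i hi z hz).2.2 j (Finset.mem_range.2 hj)).2 hO⟩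
  have h1 : DifferentiableAt ℂ (fun z : ℂ => (ε : ℂ) * z) z := by fun_prop
  exact ((hb i hi z hz).1.comp z h1).differentiableWithinAt

/-- The transfer operator has no eigenvalue outside the closed unit disc. -/
theorem FiniteCriticalOrbit.no_expanding_eigenvector (hP : FiniteCriticalOrbit D f O p q l)
    (hp : IsMotion O p q (fun i _ => p i)) {ρ : ℂ} (hρ0 : ρ ≠ 0) (hρ : ‖ρ‖ < 1) {u : ℕ → ℂ}
    (hu0 : u 0 = 0) (hu1 : u 1 = 1)
    (hu : ∀ i < q, i ≠ 0 →
      p 1 * deriv f (p i) * (ρ⁻¹ * u i) = u (nextIndex q l i) - f (p i)) : False := by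
  have h1q : 1 < q := hP.two_le
  have hp1 : p 1 ≠ 0 := hp.ne_zero 1 h1q 0 (by simp)
  obtain ⟨ε, hε, hm⟩ := hp.exists_rescale (γ := fun i z => p i + z * u i)
    (fun i _ => by fun_prop) (fun i _ => by simp) (fun z => by simp [hu0])
  obtain ⟨t, ht0, htz, htrec, C, hC⟩ := hP.exists_bounded_coeffs hm hp one_ne_zero
    (r := fun _ => 0) (t₀ := fun i => ε * u i) (fun i hi _ => by
      have : f (p i) * p 1 - p (nextIndex q l i) = 0 := by
        rw [hP.map i hi]; field_simp; ring
      simp [IsCoeff, this]) (fun i _ => by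
      have : ∀ z : ℂ, p i + ε * z * u i - p i - ε * u i * z = 0 := fun z => by ring
      simp only [IsCoeff, pow_one, this]
      exact Asymptotics.isLittleO_zero _ _) (by simp [hu0])
  -- Each lift multiplies the first-order coefficients by `ρ⁻¹`.
  have hk : ∀ k, ∀ i < q, t k i = (ρ⁻¹) ^ k * (ε * u i) := by
    intro k
    induction k with
    | zero => intro i _; simp [ht0]
    | succ k ih =>
      intro i hi
      by_cases hi0 : i = 0
      · subst hi0; simp [htz, hu0]
      · have h1 := htrec k i hi hi0
        rw [ih _ (nextIndex_lt hP.lt hi), ih 1 h1q, hu1] at h1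
        have h2 := hu i hi hi0
        have h3 : p 1 * deriv f (p i) ≠ 0 := mul_ne_zero hp1 (hP.deriv_ne_zero i hi hi0)
        apply mul_left_cancel₀ h3
        rw [h1, pow_succ]
        linear_combination (-(ρ⁻¹) ^ k * ε) * h2
  have hgrow : Tendsto (fun k : ℕ => ‖ρ⁻¹‖ ^ k) atTop atTop :=
    tendsto_pow_atTop_atTop_of_one_lt (by
      rw [norm_inv]; exact (one_lt_inv₀ (norm_pos_iff.2 hρ0)).2 hρ)
  obtain ⟨k, hk'⟩ := (hgrow.eventually_gt_atTop (C / ‖ε‖)).exists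
  have h4 := hC k 1 h1q
  rw [hk k 1 h1q, hu1, mul_one, norm_mul, norm_pow] at h4
  rw [div_lt_iff₀ (norm_pos_iff.2 hε)] at hk'
  linarith

/-- If the critical relation vanishes to a finite order along the family, then it does so to first
order. -/
theorem FiniteCriticalOrbit.no_degenerate_relation (hP : FiniteCriticalOrbit D f O p q l)
    {γ : ℕ → ℂ → ℂ} (hγ : IsMotion O p q γ) {m : ℕ} (hm : m ≠ 0) {r : ℂ} (hr0 : r ≠ 0)
    (hγf : ∀ i < q, i + 1 ≠ q → ∀ᶠ z in 𝓝 0, f (γ i z) * γ 1 z = γ (i + 1) z)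
    (hr : IsCoeff m (fun z => f (γ (q - 1) z) * γ 1 z - γ l z) r) {u : ℕ → ℂ}
    (hu0 : u 0 = 0) (hu1 : u 1 = 1)
    (hu : ∀ i < q, i ≠ 0 → u (i + 1) = p 1 * deriv f (p i) * u i + f (p i)) : u q ≠ u l := by
  intro hql
  have h1q : 1 < q := hP.two_le
  -- The motion is invariant except where the orbit closes up.
  set r' : ℕ → ℂ := fun i => if i + 1 = q then r else 0 with hr'
  obtain ⟨t, ht0, htz, htrec, C, hC⟩ := hP.exists_bounded_coeffs hγ hγ hm
    (r := r') (t₀ := fun _ => 0) (fun i hi _ => by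
      by_cases h : i + 1 = q
      · have h2 : i = q - 1 := by omega
        simp only [hr', nextIndex, h, if_true]
        rw [h2]
        exact hr
      · simp only [hr', nextIndex, h, if_false]
        have hz : IsCoeff m (fun _ => (0 : ℂ)) 0 := by simp [IsCoeff]
        refine hz.congr ?_ rfl
        filter_upwards [hγf i hi h] with z hz
        rw [hz, sub_self]) (fun i _ => by simp [IsCoeff]) rfl
  -- Summing over the lifts turns the recursion into the variational equation solved by `u`, up to a
  -- bounded error and the term `K r` at the closing index. Thus `T K i = u i * T K 1 + O(1)` along
  -- the orbit.
  set T : ℕ → ℕ → ℂ := fun K i => ∑ k ∈ Finset.range K, t k i with hT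
  have hTrec : ∀ K, ∀ i < q, i ≠ 0 → T K (nextIndex q l i) =
      p 1 * deriv f (p i) * T K i + f (p i) * T K 1 + p 1 * deriv f (p i) * t K i + K * r' i := by
    intro K i hi hi0
    have h1 : ∑ k ∈ Finset.range K, t (k + 1) i = T K i + t K i := by
      have h2 := Finset.sum_range_succ' (fun k => t k i) K
      rw [Finset.sum_range_succ] at h2
      simp only [ht0, add_zero] at h2
      exact h2.symm
    have h3 : ∑ k ∈ Finset.range K, p 1 * deriv f (p i) * t (k + 1) i =
        ∑ k ∈ Finset.range K, (t k (nextIndex q l i) - r' i - f (p i) * t k 1) :=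
      Finset.sum_congr rfl fun k _ => htrec k i hi hi0
    rw [← Finset.mul_sum, h1, Finset.sum_sub_distrib, Finset.sum_sub_distrib, ← Finset.mul_sum,
      Finset.sum_const, Finset.card_range, nsmul_eq_mul] at h3
    simp only [hT] at h3 ⊢
    linear_combination -h3
  have hstep : ∀ i < q, i ≠ 0 → (∃ B, ∀ K, ‖T K i - u i * T K 1‖ ≤ B) →
      ∃ B, ∀ K : ℕ, ‖T K (nextIndex q l i) - u (i + 1) * T K 1 - K * r' i‖ ≤ B := by
    rintro i hi hi0 ⟨B, hB⟩
    refine ⟨‖p 1 * deriv f (p i)‖ * (B + C), fun K => ?_⟩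
    have : T K (nextIndex q l i) - u (i + 1) * T K 1 - K * r' i =
        p 1 * deriv f (p i) * ((T K i - u i * T K 1) + t K i) := by
      rw [hTrec K i hi hi0, hu i hi hi0]; ring
    rw [this, norm_mul]
    gcongr
    exact (norm_add_le _ _).trans (add_le_add (hB K) (hC K i hi))
  have hbd : ∀ i < q, ∃ B, ∀ K, ‖T K i - u i * T K 1‖ ≤ B := by
    intro i
    induction i with
    | zero => exact fun _ => ⟨0, fun K => by simp [hT, htz, hu0]⟩
    | succ i ih =>
      intro hi
      by_cases hi0 : i = 0
      · subst hi0
        exact ⟨0, fun K => by simp [hu1]⟩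
      · obtain ⟨B, hB⟩ := hstep i (by omega) hi0 (ih (by omega))
        refine ⟨B, fun K => ?_⟩
        have := hB K
        have h1 : nextIndex q l i = i + 1 := by unfold nextIndex; rw [if_neg (by omega)]
        have h2 : r' i = 0 := by simp only [hr']; rw [if_neg (by omega)]
        rwa [h1, h2, mul_zero, sub_zero] at this
  obtain ⟨B, hB⟩ := hstep (q - 1) (by omega) (by omega) (hbd (q - 1) (by omega))
  obtain ⟨B', hB'⟩ := hbd l hP.lt
  have hq1 : q - 1 + 1 = q := by omega
  have h1 : nextIndex q l (q - 1) = l := by unfold nextIndex; rw [if_pos hq1]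
  have h2 : r' (q - 1) = r := by simp only [hr']; rw [if_pos hq1]
  rw [h1, h2, hq1, hql] at hB
  obtain ⟨K, hK⟩ := exists_nat_gt ((B + B') / ‖r‖)
  rw [div_lt_iff₀ (norm_pos_iff.2 hr0)] at hK
  -- As `u q = u l`, the two estimates of `T K l` differ by `K r`, which would have to stay bounded.
  have h3 : (K : ℂ) * r = (T K l - u l * T K 1) - (T K l - u l * T K 1 - K * r) := by ring
  have h4 : ‖(K : ℂ) * r‖ ≤ B' + B := by
    rw [h3]
    exact (norm_sub_le _ _).trans (add_le_add (hB' K) (hB K))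
  rw [norm_mul, Complex.norm_natCast] at h4
  linarith

/-! ### Deformation in `ρ` from the multiplier to the parameter derivative. -/

/-- The weighted sums whose values at `ρ = 1` are the parameter derivatives of the critical orbit
with multipliers `μ n` and parameter partial derivatives `L n`. -/
noncomputable def weightedDeriv (μ L : ℕ → ℝ) (ρ : ℝ) : ℕ → ℝ
  | 0 => 0
  | n + 1 => ρ ^ n * L n + μ n * weightedDeriv μ L ρ n

theorem continuous_weightedDeriv (μ L : ℕ → ℝ) (n : ℕ) :
    Continuous fun ρ => weightedDeriv μ L ρ n := by
  induction n with
  | zero => exact continuous_const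
  | succ n ih => simp only [weightedDeriv]; fun_prop

theorem weightedDeriv_zero {μ L : ℕ → ℝ} (hL : L 0 = 1) {n : ℕ} (hn : 0 < n) :
    weightedDeriv μ L 0 n = ∏ k ∈ Finset.Ico 1 n, μ k := by
  induction n, hn using Nat.le_induction with
  | base => simp [weightedDeriv, hL]
  | succ n hn ih =>
    have hn : 1 ≤ n := hn
    rw [weightedDeriv, ih, zero_pow (by omega), zero_mul, zero_add, Finset.prod_Ico_succ_top hn,
      mul_comm]

/-- The quotient is continuous in `ρ` and equals `1` at `ρ = 0`, where only the term `L 0` survives;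
without a zero on `(0, 1]` it stays positive. -/
theorem weightedDeriv_sub_div_pos {μ L : ℕ → ℝ} (hL : L 0 = 1) {q l : ℕ} (hlq : l < q)
    (hμ : ∀ n, 1 ≤ n → n < q → μ n ≠ 0)
    (hne : ∀ ρ : ℝ, 0 < ρ → ρ ≤ 1 →
      weightedDeriv μ L ρ q ≠ ρ ^ (q - l) * weightedDeriv μ L ρ l) :
    0 < (weightedDeriv μ L 1 q - weightedDeriv μ L 1 l) / ∏ k ∈ Finset.Ico 1 q, μ k := by
  set P := ∏ k ∈ Finset.Ico 1 q, μ k with hP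
  have hP0 : P ≠ 0 := Finset.prod_ne_zero_iff.2 fun k hk => by
    rw [Finset.mem_Ico] at hk; exact hμ k hk.1 hk.2
  set F : ℝ → ℝ := fun ρ => (weightedDeriv μ L ρ q - ρ ^ (q - l) * weightedDeriv μ L ρ l) / P
    with hF
  have hFc : Continuous F := ((continuous_weightedDeriv μ L q).sub
    ((continuous_pow _).mul (continuous_weightedDeriv μ L l))).div_const _
  have hF0 : F 0 = 1 := by
    simp only [hF]
    rw [weightedDeriv_zero hL (by omega), zero_pow (by omega), zero_mul, sub_zero, div_self hP0]
  by_contra! h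
  have hF1 : F 1 ≤ 0 := by simpa [hF] using h
  obtain ⟨ρ, hρ, hρ0⟩ := intermediate_value_Icc' zero_le_one hFc.continuousOn
    (show (0 : ℝ) ∈ Icc (F 1) (F 0) by rw [hF0]; exact ⟨hF1, zero_le_one⟩)
  have hρpos : 0 < ρ := lt_of_le_of_ne hρ.1 (by rintro rfl; rw [hF0] at hρ0; norm_num at hρ0)
  refine hne ρ hρpos hρ.2 (sub_eq_zero.1 ?_)
  simp only [hF] at hρ0
  rcases div_eq_zero_iff.1 hρ0 with h | h
  · exact h
  · exact absurd h hP0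

/-- Positive transversality for the weighted sums along a finite critical orbit of real points. -/
theorem FiniteCriticalOrbit.weightedDeriv_pos (hP : FiniteCriticalOrbit D f O p q l)
    (hp : IsMotion O p q (fun i _ => p i)) {γ : ℕ → ℂ → ℂ}
    (hγ : ∀ i < q, AnalyticAt ℂ (γ i) 0) (hγ0 : ∀ i < q, γ i 0 = p i) (hc : ∀ z, γ 0 z = p 0)
    (hγf : ∀ i < q, i + 1 ≠ q → ∀ᶠ z in 𝓝 0, f (γ i z) * γ 1 z = γ (i + 1) z)
    (hnz : ¬ ∀ᶠ z in 𝓝 0, f (γ (q - 1) z) * γ 1 z - γ l z = 0) {μ L : ℕ → ℝ} (hL : L 0 = 1)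
    (hLf : ∀ i < q, f (p i) = L i) (hμ : ∀ i < q, i ≠ 0 → p 1 * deriv f (p i) = μ i) :
    0 < (weightedDeriv μ L 1 q - weightedDeriv μ L 1 l) / ∏ k ∈ Finset.Ico 1 q, μ k := by
  have h1q : 1 < q := hP.two_le
  have hp1 : p 1 ≠ 0 := hp.ne_zero 1 h1q 0 (by simp)
  refine weightedDeriv_sub_div_pos hL hP.lt (fun n hn hnq h => ?_) fun ρ hρ0 hρ1 heq => ?_
  · have h1 := hμ n hnq (by omega)
    rw [h, Complex.ofReal_zero] at h1
    exact mul_ne_zero hp1 (hP.deriv_ne_zero n hnq (by omega)) h1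
  set v := weightedDeriv μ L ρ with hv
  -- Dividing by `ρ ^ (n - 1)`, written without truncated subtraction, turns the weighted recursion
  -- into the eigenvector equation with eigenvalue `ρ⁻¹` and gives `u 1 = 1`.
  set u : ℕ → ℂ := fun n => ((ρ * v n / ρ ^ n : ℝ) : ℂ) with hu
  have hu0 : u 0 = 0 := by simp [hu, hv, weightedDeriv]
  have hu1 : u 1 = 1 := by
    simp only [hu, hv, weightedDeriv, hL]
    norm_num
    exact hρ0.ne'
  have hrec : ∀ i < q, i ≠ 0 → u (i + 1) = p 1 * deriv f (p i) * ((ρ : ℂ)⁻¹ * u i) + f (p i) := by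
    intro i hi hi0
    rw [hμ i hi hi0, hLf i hi]
    simp only [hu, hv, weightedDeriv]
    norm_cast
    field_simp
    ring
  have hql : u q = u l := by
    simp only [hu]
    rw [heq]
    congr 1
    have : ρ ^ q = ρ ^ (q - l) * ρ ^ l := by rw [← pow_add]; congr 1; have := hP.lt; omega
    rw [this]
    field_simp
  rcases hρ1.lt_or_eq with hlt | rfl
  · refine hP.no_expanding_eigenvector hp (ρ := ρ) (by exact_mod_cast hρ0.ne')
      (by rw [Complex.norm_real, Real.norm_of_nonneg hρ0.le]; exact hlt) hu0 hu1
      fun i hi hi0 => ?_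
    have h1 := hrec i hi hi0
    have h2 : u (nextIndex q l i) = u (i + 1) := by
      unfold nextIndex
      split_ifs with h
      · rw [h, hql]
      · rfl
    rw [h2, h1]; ring
  · obtain ⟨ε, hε, hm⟩ := hp.exists_rescale hγ hγ0 hc
    have hεt : Tendsto (fun z : ℂ => ε * z) (𝓝 0) (𝓝 0) := by
      have : Tendsto (fun z : ℂ => ε * z) (𝓝 0) (𝓝 (ε * 0)) :=
        (continuous_const.mul continuous_id).tendsto 0
      rwa [mul_zero] at this
    set R : ℂ → ℂ := fun z => f (γ (q - 1) z) * γ 1 z - γ l z with hR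
    have hq1 : q - 1 < q := by omega
    have hRa : AnalyticAt ℂ R 0 := by
      refine (AnalyticAt.mul ?_ (hγ 1 h1q)).sub (hγ l hP.lt)
      refine AnalyticAt.fun_comp ?_ (hγ _ hq1)
      rw [hγ0 _ hq1]
      exact hP.holo.analyticAt (hP.isOpen.mem_nhds (hP.mem _ hq1))
    -- `m` is the order of vanishing of the critical relation; it is finite by `hnz` and nonzero
    -- because the relation holds at the base parameter.
    obtain ⟨m, g, hg, hg0, hRg⟩ := hRa.exists_eventuallyEq_pow_smul_nonzero_iff.2 hnz
    have hm0 : m ≠ 0 := by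
      rintro rfl
      have h1 := hRg.self_of_nhds
      simp only [hR, hγ0 _ hq1, hγ0 1 h1q, hγ0 l hP.lt, pow_zero, one_smul] at h1
      rw [hP.map _ hq1] at h1
      have h2 : nextIndex q l (q - 1) = l := by unfold nextIndex; rw [if_pos (by omega)]
      rw [h2, div_mul_cancel₀ _ hp1, sub_self] at h1
      exact hg0 h1.symm
    have hcoeff : IsCoeff m (fun z => R (ε * z)) (g 0 * ε ^ m) := by
      have h1 : IsCoeff m (fun z : ℂ => ε ^ m * z ^ m) (ε ^ m) := by simp [IsCoeff]
      have h2 := h1.mul_tendsto (hg.continuousAt.tendsto.comp hεt)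
      refine h2.congr ?_ rfl
      filter_upwards [hεt.eventually hRg] with z hz
      rw [hz]
      simp only [Function.comp_apply, sub_zero, smul_eq_mul, mul_pow]
      ring
    refine hP.no_degenerate_relation hm hm0 (mul_ne_zero hg0 (pow_ne_zero m hε))
      (fun i hi hiq => hεt.eventually (hγf i hi hiq)) hcoeff hu0 hu1 (fun i hi hi0 => ?_) hql
    have := hrec i hi hi0
    rwa [Complex.ofReal_one, inv_one, one_mul] at this

end Transversality

/-! ### Real shape of `f` on the unimodal part. -/

section UnimodalPart

variable {D : Set ℂ} {f : ℂ → ℂ} {c X : ℝ}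

theorem IsRealSurjective.apply_ofReal (hf : IsRealSurjective D f) {y : ℝ} (hy : (y : ℂ) ∈ D) :
    f y = ((f y).re : ℂ) := by
  apply Complex.ext
  · simp
  · simpa using hf.real y hy

theorem IsRealSurjective.hasDerivAt_re (hf : IsRealSurjective D f) {y : ℝ} (hy : (y : ℂ) ∈ D) :
    HasDerivAt (fun x : ℝ => (f x).re) (deriv f y).re y :=
  (hf.holo.differentiableAt (hf.isOpen.mem_nhds hy)).hasDerivAt.real_of_complex

theorem IsRealSurjective.deriv_ofReal (hf : IsRealSurjective D f) {y : ℝ} (hy : (y : ℂ) ∈ D) :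
    deriv f y = ((deriv f y).re : ℂ) := by
  have h1 := (hf.holo.differentiableAt (hf.isOpen.mem_nhds hy)).hasDerivAt.comp_ofReal
  have h2 := (hf.hasDerivAt_re hy).ofReal_comp
  refine h1.unique (h2.congr_of_eventuallyEq ?_)
  filter_upwards [Complex.continuous_ofReal.continuousAt.preimage_mem_nhds
    (hf.isOpen.mem_nhds hy)] with x hx
  exact hf.apply_ofReal hx

theorem IsRealSurjective.isCriticalValue_of_deriv (hf : IsRealSurjective D f) {y : ℝ}
    (hy : (y : ℂ) ∈ D) (h : (deriv f y).re = 0) : IsCriticalValue D f ((f y).re : ℂ) :=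
  ⟨y, hy, by rw [hf.deriv_ofReal hy, h, Complex.ofReal_zero], hf.apply_ofReal hy⟩

theorem IsRealSurjective.isCriticalValue_of_isLocalExtr (hf : IsRealSurjective D f) {y : ℝ}
    (hy : (y : ℂ) ∈ D) (h : IsLocalExtr (fun x : ℝ => (f x).re) y) :
    IsCriticalValue D f ((f y).re : ℂ) :=
  hf.isCriticalValue_of_deriv hy (h.hasDerivAt_eq_zero (hf.hasDerivAt_re hy))

theorem IsRealSurjective.Icc_mem (hf : IsRealSurjective D f) {y : ℝ} (hy : (y : ℂ) ∈ D) :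
    ∀ x ∈ Icc 0 y, (x : ℂ) ∈ D := by
  intro x hx
  have h0 : ((0 : ℝ) : ℂ) ∈ D := by simpa using hf.zero_mem
  exact hf.interval.out (x := (0 : ℝ)) h0 (y := y) hy hx

/-- A map which is not constant on `D` is not constant on any real interval. -/
theorem IsRealSurjective.not_eventually_const (hf : IsRealSurjective D f) {y v : ℝ}
    (hy : (y : ℂ) ∈ D) {s : Set ℝ} (hs : (𝓝[s \ {y}] y).NeBot) :
    ¬ ∀ x ∈ s, (x : ℂ) ∈ D ∧ (f x).re = v := by
  intro h
  have hmap : Tendsto (fun x : ℝ => (x : ℂ)) (𝓝[s \ {y}] y) (𝓝[≠] (y : ℂ)) := by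
    apply tendsto_nhdsWithin_of_tendsto_nhds_of_eventually_within
    · exact (Complex.continuous_ofReal.tendsto y).mono_left nhdsWithin_le_nhds
    · filter_upwards [self_mem_nhdsWithin] with x hx
      simpa using hx.2
  have hfreq : ∃ᶠ z in 𝓝[≠] (y : ℂ), f z = v := by
    refine hmap.frequently (Eventually.frequently ?_)
    filter_upwards [self_mem_nhdsWithin] with x hx
    obtain ⟨h1, h2⟩ := h x hx.1
    rw [hf.apply_ofReal h1, h2]
  have heq := (hf.holo.analyticOnNhd hf.isOpen).eqOn_of_preconnected_of_frequently_eq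
    (analyticOnNhd_const (v := (v : ℂ))) hf.isPreconnected hy hfreq
  obtain ⟨z, hz, hz'⟩ : (v : ℂ) + 1 ∈ f '' D := by rw [hf.surj]; trivial
  rw [heq hz] at hz'
  simp at hz'

theorem IsFirstPositiveMax.value (hf : IsRealSurjective D f) {O : Prop}
    (hcrit : ∀ v : ℂ, IsCriticalValue D f v → v = 0 ∨ v = 1 ∨ (O ∧ v = -1))
    (hc : IsFirstPositiveMax D f c) : (f c).re = 1 := by
  obtain ⟨⟨-, hcD, hpos, hmax⟩, -⟩ := hc
  rcases hcrit _ (hf.isCriticalValue_of_isLocalExtr hcD hmax.isExtr) with h | h | ⟨-, h⟩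
  · have : (f c).re = 0 := by exact_mod_cast h
    linarith
  · exact_mod_cast h
  · have : (f c).re = -1 := by exact_mod_cast h
    linarith

theorem IsRealSurjective.continuousOn_re (hf : IsRealSurjective D f) {s : Set ℝ}
    (hs : ∀ x ∈ s, (x : ℂ) ∈ D) : ContinuousOn (fun x : ℝ => (f x).re) s :=
  fun x hx => (hf.hasDerivAt_re (hs x hx)).continuousAt.continuousWithinAt

theorem IsFirstPositiveMax.not_isMaxOn (hf : IsRealSurjective D f) (hc : IsFirstPositiveMax D f c)
    {y z : ℝ} (hz : z ≤ c) (hy : y ∈ Ioo 0 z) (hpos : 0 < (f y).re) :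
    ¬ IsMaxOn (fun x : ℝ => (f x).re) (Icc 0 z) y := by
  intro h
  have := hc.2 ⟨hy.1, hf.Icc_mem hc.1.2.1 y ⟨hy.1.le, hy.2.le.trans hz⟩, hpos,
    h.isLocalMax (Icc_mem_nhds hy.1 hy.2)⟩
  linarith [hy.2]

/-- Maps in the class `ℰ` are positive to the left of the turning point. -/
theorem ClassE.pos_of_mem (hf : ClassE D f) (hc : IsFirstPositiveMax D f c) :
    ∀ y ∈ Ioo 0 c, 0 < (f y).re := by
  have hR := hf.toIsRealSurjective
  have hcD := hc.1.2.1
  have hmem := hR.Icc_mem hcD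
  have hc0 := hc.1.1
  have hf0 : (f (0 : ℝ)).re = 0 := by simp [hR.map_zero]
  -- A negative minimum would be interior, hence a critical value other than `0` and `1`.
  have hnonneg : ∀ y ∈ Icc 0 c, 0 ≤ (f y).re := by
    obtain ⟨y, hy, hmin⟩ := isCompact_Icc.exists_isMinOn (nonempty_Icc.2 hc0.le)
      (hR.continuousOn_re hmem)
    have hge : 0 ≤ (f y).re := by
      by_contra! h
      have hy0 : 0 < y := lt_of_le_of_ne hy.1 (by rintro rfl; rw [hf0] at h; exact lt_irrefl _ h)
      have hyc : y < c := lt_of_le_of_ne hy.2 (by rintro rfl; exact lt_asymm h hc.1.2.2.1)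
      have h1 := hR.isCriticalValue_of_isLocalExtr (hmem y hy)
        (hmin.isLocalMin (Icc_mem_nhds hy0 hyc)).isExtr
      rcases hf.critical _ h1 with h2 | h2
      · have : (f y).re = 1 := by exact_mod_cast h2
        linarith
      · have : (f y).re = 0 := by exact_mod_cast h2
        linarith
    exact fun x hx => hge.trans (hmin hx)
  intro y hy
  refine lt_of_le_of_ne (hnonneg y ⟨hy.1.le, hy.2.le⟩) fun h0 => ?_
  -- If `f y = 0`, a positive maximum on `[0, y]` would be a local maximum before `c`; so `f`
  -- vanishes on `[0, y]`, against the identity theorem.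
  have hsub : ∀ x ∈ Icc 0 y, (x : ℂ) ∈ D := fun x hx => hmem x ⟨hx.1, hx.2.trans hy.2.le⟩
  obtain ⟨z, hz, hmax⟩ := isCompact_Icc.exists_isMaxOn (nonempty_Icc.2 hy.1.le)
    (hR.continuousOn_re hsub)
  have hz0 : (f z).re ≤ 0 := by
    by_contra! h
    have hz1 : 0 < z := lt_of_le_of_ne hz.1 (by rintro rfl; rw [hf0] at h; exact lt_irrefl _ h)
    have hz2 : z < y := lt_of_le_of_ne hz.2 (by rintro rfl; rw [← h0] at h; exact lt_irrefl _ h)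
    exact hc.not_isMaxOn hR hy.2.le ⟨hz1, hz2⟩ h hmax
  refine hR.not_eventually_const (y := 0) (v := 0) (s := Icc 0 y) (by simpa using hR.zero_mem) ?_
    fun x hx => ⟨hsub x hx, le_antisymm ((hmax hx).trans hz0) (hnonneg x ⟨hx.1, hx.2.trans hy.2.le⟩)⟩
  rw [Icc_sdiff_left, nhdsWithin_Ioc_eq_nhdsGT hy.1]
  infer_instance

/-- The shape of the unimodal part of `f`, up to a point `X` before its right end point. -/
structure IsUnimodalOn (f : ℂ → ℂ) (c X : ℝ) : Prop where
  pos_c : 0 < c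
  c_lt : c < X
  zero : (f (0 : ℝ)).re = 0
  at_c : (f c).re = 1
  pos : ∀ y ∈ Ioc 0 X, 0 < (f y).re
  lt_one : ∀ y ∈ Ioc 0 X, y ≠ c → (f y).re < 1
  deriv_c : (deriv f c).re = 0
  deriv_pos : ∀ y ∈ Ioo 0 c, 0 < (deriv f y).re
  deriv_neg : ∀ y ∈ Ioo c X, (deriv f y).re < 0

/-- Where `f > 0` the only critical value is `1`. Once `f < 1` is known off `c`, there are no other
critical points, so the derivative keeps one sign on each side of `c`, read off from the mean value
theorem. -/
theorem IsFirstPositiveMax.isUnimodalOn (hf : IsRealSurjective D f) {O : Prop}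
    (hcrit : ∀ v : ℂ, IsCriticalValue D f v → v = 0 ∨ v = 1 ∨ (O ∧ v = -1))
    (hc : IsFirstPositiveMax D f c) (hpos : ∀ y ∈ Ioo 0 c, 0 < (f y).re) (hX : c < X)
    (hXD : ∀ y ∈ Icc c X, (y : ℂ) ∈ D ∧ 0 < (f y).re) : IsUnimodalOn f c X := by
  have hc1 := hc.value hf hcrit
  have hc0 := hc.1.1
  have hcD := hc.1.2.1
  have hmem := hf.Icc_mem (hXD X ⟨hX.le, le_rfl⟩).1
  have hf0 : (f (0 : ℝ)).re = 0 := by simp [hf.map_zero]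
  have hposX : ∀ y ∈ Ioc 0 X, 0 < (f y).re := by
    intro y hy
    rcases lt_or_ge y c with h | h
    · exact hpos y ⟨hy.1, h⟩
    · exact (hXD y ⟨h, hy.2⟩).2
  have hcrit1 : ∀ y ∈ Ioc 0 X, IsCriticalValue D f ((f y).re : ℂ) → (f y).re = 1 := by
    intro y hy h
    have hp := hposX y hy
    rcases hcrit _ h with h | h | ⟨-, h⟩
    · have : (f y).re = 0 := by exact_mod_cast h
      linarith
    · exact_mod_cast h
    · have : (f y).re = -1 := by exact_mod_cast h
      linarith
  have hlt : ∀ y ∈ Ioc 0 X, y ≠ c → (f y).re < 1 := by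
    intro y hy hyc
    rcases lt_or_gt_of_ne hyc with h | h
    · by_contra! hge
      have hsub : ∀ x ∈ Icc 0 c, (x : ℂ) ∈ D := fun x hx => hmem x ⟨hx.1, hx.2.trans hX.le⟩
      obtain ⟨z, hz, hmax⟩ := isCompact_Icc.exists_isMaxOn (nonempty_Icc.2 hc0.le)
        (hf.continuousOn_re hsub)
      have hyz : (f y).re ≤ (f z).re := hmax (show y ∈ Icc 0 c from ⟨hy.1.le, h.le⟩)
      have hz0 : 0 < z := lt_of_le_of_ne hz.1 (by rintro rfl; rw [hf0] at hyz; linarith)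
      rcases hz.2.lt_or_eq with hzc | rfl
      · exact hc.not_isMaxOn hf le_rfl ⟨hz0, hzc⟩ (by linarith) hmax
      · have hmax' : IsMaxOn (fun x : ℝ => (f x).re) (Icc 0 z) y := fun x hx => by
          have : (f x).re ≤ (f z).re := hmax hx
          show (f x).re ≤ (f y).re
          linarith
        exact hc.not_isMaxOn hf le_rfl ⟨hy.1, h⟩ (by linarith) hmax'
    · by_contra! hge
      have hsub : ∀ x ∈ Icc c y, (x : ℂ) ∈ D := fun x hx =>
        hmem x ⟨hc0.le.trans hx.1, hx.2.trans hy.2⟩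
      obtain ⟨z, hz, hmin⟩ := isCompact_Icc.exists_isMinOn (nonempty_Icc.2 h.le)
        (hf.continuousOn_re hsub)
      -- A smaller minimum on `[c, y]` would be interior and have critical value `1`. Hence `f ≥ 1`
      -- on `[c, y]`; as `c` is a local maximum, `f = 1` just to the right of `c`, which is
      -- impossible.
      have hz1 : 1 ≤ (f z).re := by
        by_contra! hz1
        have hzc : c < z := lt_of_le_of_ne hz.1 (by rintro rfl; linarith)
        have hzy : z < y := lt_of_le_of_ne hz.2 (by rintro rfl; linarith)
        have := hcrit1 z ⟨hc0.trans hzc, hz.2.trans hy.2⟩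
          (hf.isCriticalValue_of_isLocalExtr (hsub z hz)
            (hmin.isLocalMin (Icc_mem_nhds hzc hzy)).isExtr)
        linarith
      obtain ⟨ε, hε, hball⟩ := Metric.eventually_nhds_iff_ball.1 hc.1.2.2.2
      have hmin' : c < min (c + ε) y := lt_min (by linarith) h
      refine hf.not_eventually_const (y := c) (v := 1) (s := Ico c (min (c + ε) y)) hcD ?_
        fun x hx => ?_
      · rw [Ico_sdiff_left, nhdsWithin_Ioo_eq_nhdsGT hmin']
        infer_instance
      · have hxy : x ∈ Icc c y := ⟨hx.1, hx.2.le.trans (min_le_right _ _)⟩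
        refine ⟨hsub x hxy, le_antisymm ?_ (hz1.trans (hmin hxy))⟩
        rw [← hc1]
        refine hball x ?_
        rw [Metric.mem_ball, Real.dist_eq, abs_lt]
        constructor
        · linarith [hx.1]
        · linarith [hx.2, min_le_left (c + ε) y]
  have hne : ∀ y ∈ Ioc 0 X, y ≠ c → (deriv f y).re ≠ 0 := fun y hy hyc h0 => by
    have := hcrit1 y hy (hf.isCriticalValue_of_deriv (hmem y ⟨hy.1.le, hy.2⟩) h0)
    linarith [hlt y hy hyc]
  refine ⟨hc0, hX, hf0, hc1, hposX, hlt, ?_, ?_, ?_⟩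
  · exact hc.1.2.2.2.hasDerivAt_eq_zero (hf.hasDerivAt_re hcD)
  · obtain ⟨ξ, hξ, hξ'⟩ := exists_hasDerivAt_eq_slope (fun x : ℝ => (f x).re)
      (fun x : ℝ => (deriv f x).re) hc0
      (hf.continuousOn_re fun x hx => hmem x ⟨hx.1, hx.2.trans hX.le⟩)
      (fun x hx => hf.hasDerivAt_re (hmem x ⟨hx.1.le, hx.2.le.trans hX.le⟩))
    have hξpos : 0 < (deriv f ξ).re := by
      rw [hξ', hf0, hc1]
      exact div_pos (by norm_num) (by linarith)
    rcases hasDerivWithinAt_forall_lt_or_forall_gt_of_forall_ne (convex_Ioo 0 c)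
      (f := fun x : ℝ => (f x).re) (f' := fun x : ℝ => (deriv f x).re) (m := 0)
      (fun x hx => (hf.hasDerivAt_re
        (hmem x ⟨hx.1.le, hx.2.le.trans hX.le⟩)).hasDerivWithinAt)
      (fun x hx => hne x ⟨hx.1, hx.2.le.trans hX.le⟩ hx.2.ne) with h | h
    · exact absurd (h ξ hξ) (not_lt.2 hξpos.le)
    · exact h
  · obtain ⟨ξ, hξ, hξ'⟩ := exists_hasDerivAt_eq_slope (fun x : ℝ => (f x).re)
      (fun x : ℝ => (deriv f x).re) hX
      (hf.continuousOn_re fun x hx => hmem x ⟨hc0.le.trans hx.1, hx.2⟩)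
      (fun x hx => hf.hasDerivAt_re (hmem x ⟨hc0.le.trans hx.1.le, hx.2.le⟩))
    have hξneg : (deriv f ξ).re < 0 := by
      rw [hξ', hc1]
      exact div_neg_of_neg_of_pos
        (by linarith [hlt X ⟨hc0.trans hX, le_rfl⟩ hX.ne']) (by linarith)
    rcases hasDerivWithinAt_forall_lt_or_forall_gt_of_forall_ne (convex_Ioo c X)
      (f := fun x : ℝ => (f x).re) (f' := fun x : ℝ => (deriv f x).re) (m := 0)
      (fun x hx => (hf.hasDerivAt_re
        (hmem x ⟨hc0.le.trans hx.1.le, hx.2.le⟩)).hasDerivWithinAt)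
      (fun x hx => hne x ⟨hc0.trans hx.1, hx.2.le⟩ hx.1.ne') with h | h
    · exact h
    · exact absurd (h ξ hξ) (not_lt.2 hξneg.le)

end UnimodalPart

/-! ### The critical orbit as a function of the parameter. -/

section CriticalOrbits

variable {D : Set ℂ} {f : ℂ → ℂ} {c X : ℝ}

/-- The derivative of `a * f` along the orbit of `c`. -/
noncomputable def orbitMultiplier (f : ℂ → ℂ) (c a : ℝ) (k : ℕ) : ℝ :=
  a * (deriv f ((mulFamily f a)^[k] c : ℝ)).re

/-- The derivative of `a * f` with respect to `a` along the orbit of `c`. -/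
noncomputable def orbitPartial (f : ℂ → ℂ) (c a : ℝ) (k : ℕ) : ℝ :=
  (f ((mulFamily f a)^[k] c : ℝ)).re

/-- The iterates of `c` as functions of a complex parameter. -/
noncomputable def complexOrbit (f : ℂ → ℂ) (c : ℝ) : ℕ → ℂ → ℂ
  | 0 => fun _ => c
  | n + 1 => fun w => w * f (complexOrbit f c n w)

theorem iterate_mulFamily_succ (a : ℝ) (n : ℕ) : (mulFamily f a)^[n + 1] c =
    a * (f ((mulFamily f a)^[n] c : ℝ)).re := by
  rw [Function.iterate_succ_apply']; rfl

namespace IsUnimodalOn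

variable (hU : IsUnimodalOn f c X)
include hU

theorem pos_of_Icc {y : ℝ} (hy : y ∈ Ioc 0 X) : 0 < (f y).re ∧ (f y).re ≤ 1 := by
  refine ⟨hU.pos y hy, ?_⟩
  by_cases h : y = c
  · rw [h, hU.at_c]
  · exact (hU.lt_one y hy h).le

theorem mulFamily_mem {a : ℝ} (ha : 0 < a) {y : ℝ} (hy : y ∈ Ioc 0 X) :
    mulFamily f a y ∈ Ioc 0 a := by
  obtain ⟨h1, h2⟩ := hU.pos_of_Icc hy
  exact ⟨mul_pos ha h1, mul_le_of_le_one_right ha.le h2⟩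

theorem iterate_mem {a : ℝ} (ha : 0 < a) (haX : a < X) (n : ℕ) :
    (mulFamily f a)^[n] c ∈ Ioo 0 X ∧ (n ≠ 0 → (mulFamily f a)^[n] c ≤ a) := by
  induction n with
  | zero => exact ⟨⟨hU.pos_c, hU.c_lt⟩, fun h => absurd rfl h⟩
  | succ n ih =>
    rw [Function.iterate_succ_apply']
    have := hU.mulFamily_mem ha (Ioo_subset_Ioc_self ih.1)
    exact ⟨⟨this.1, this.2.trans_lt haX⟩, fun _ => this.2⟩

theorem mulFamily_c (a : ℝ) : mulFamily f a c = a := by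
  rw [mulFamily, hU.at_c, mul_one]

theorem eq_c_of_re_eq_one {y : ℝ} (hy : y ∈ Ioc 0 X) (h : (f y).re = 1) : y = c := by
  by_contra hne
  exact (hU.lt_one y hy hne).ne h

theorem sign_orbitMultiplier {a : ℝ} (ha : 0 < a) (haX : a < X) (k : ℕ) :
    SignType.sign (orbitMultiplier f c a k) = -kneading (mulFamily f a) c k := by
  have hmem := (hU.iterate_mem ha haX k).1
  rw [orbitMultiplier, kneading, sign_mul, sign_pos ha, one_mul]
  rcases lt_trichotomy ((mulFamily f a)^[k] c) c with h | h | h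
  · rw [sign_pos (hU.deriv_pos _ ⟨hmem.1, h⟩), sign_neg (sub_neg.2 h), neg_neg]
  · rw [h, hU.deriv_c, sub_self]; simp
  · rw [sign_neg (hU.deriv_neg _ ⟨h, hmem.2⟩), sign_pos (sub_pos.2 h)]

variable (hf : IsRealSurjective D f) (hD : ∀ y ∈ Icc 0 X, (y : ℂ) ∈ D)
include hf hD

theorem hasDerivAt_param {a : ℝ} (ha : 0 < a) (haX : a < X) (n : ℕ) :
    HasDerivAt (fun w => (mulFamily f w)^[n] c)
      (weightedDeriv (orbitMultiplier f c a) (orbitPartial f c a) 1 n) a := by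
  induction n with
  | zero => exact hasDerivAt_const a c
  | succ n ih =>
    have hmem := (hU.iterate_mem ha haX n).1
    have h1 := (hasDerivAt_id a).mul
      ((hf.hasDerivAt_re (hD _ ⟨hmem.1.le, hmem.2.le⟩)).comp a ih)
    simp only [iterate_mulFamily_succ]
    refine h1.congr_deriv ?_
    simp only [weightedDeriv, orbitMultiplier, orbitPartial, Function.comp_apply, id]
    ring

theorem hasDerivAt_iterate {a : ℝ} (ha : 0 < a) (haX : a < X) (n : ℕ) :
    HasDerivAt ((mulFamily f a)^[n]) (∏ k ∈ Finset.Ico 1 (n + 1), orbitMultiplier f c a k)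
      (mulFamily f a c) := by
  induction n with
  | zero => simpa using hasDerivAt_id (mulFamily f a c)
  | succ n ih =>
    have hmem := (hU.iterate_mem ha haX (n + 1)).1
    rw [Function.iterate_succ', Finset.prod_Ico_succ_top (by omega), mul_comm]
    refine HasDerivAt.comp _ ?_ ih
    rw [← Function.iterate_succ_apply]
    exact (hf.hasDerivAt_re (hD _ ⟨hmem.1.le, hmem.2.le⟩)).const_mul a

theorem complexOrbit_ofReal {a : ℝ} (ha : 0 < a) (haX : a < X) (n : ℕ) :
    complexOrbit f c n a = (((mulFamily f a)^[n] c : ℝ) : ℂ) := by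
  induction n with
  | zero => rfl
  | succ n ih =>
    have hmem := (hU.iterate_mem ha haX n).1
    show (a : ℂ) * f (complexOrbit f c n a) = _
    rw [ih, iterate_mulFamily_succ, hf.apply_ofReal (hD _ ⟨hmem.1.le, hmem.2.le⟩)]
    push_cast
    rfl

theorem analyticAt_complexOrbit {a : ℝ} (ha : 0 < a) (haX : a < X) (n : ℕ) :
    AnalyticAt ℂ (complexOrbit f c n) a := by
  induction n with
  | zero => exact analyticAt_const
  | succ n ih =>
    have hmem := (hU.iterate_mem ha haX n).1
    refine analyticAt_id.mul (AnalyticAt.fun_comp ?_ ih)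
    rw [hU.complexOrbit_ofReal hf hD ha haX]
    exact hf.holo.analyticAt (hf.isOpen.mem_nhds (hD _ ⟨hmem.1.le, hmem.2.le⟩))

/-- For small parameters the orbit of `c` is strictly decreasing. -/
theorem exists_strictAnti :
    ∃ w : ℝ, 0 < w ∧ w < X ∧ StrictAnti fun n => (mulFamily f w)^[n] c := by
  have hX : 0 < X := hU.pos_c.trans hU.c_lt
  have h0 := hf.hasDerivAt_re (hD 0 ⟨le_rfl, hX.le⟩)
  obtain ⟨M, hM⟩ := h0.isBigO_sub.bound
  obtain ⟨δ, hδ, hball⟩ := Metric.eventually_nhds_iff_ball.1 hM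
  have hM1 : 0 < |M| + 1 := by positivity
  -- The bounds keep the orbit, after its first step, where `|f y| ≤ |M| y`, make that first step
  -- decrease, and give `w |M| < 1`.
  set w := min (min (δ / 2) (c / 2)) (1 / (|M| + 1)) with hw
  have hwδ : w ≤ δ / 2 := (min_le_left _ _).trans (min_le_left _ _)
  have hwc : w ≤ c / 2 := (min_le_left _ _).trans (min_le_right _ _)
  have hwM : w ≤ 1 / (|M| + 1) := min_le_right _ _
  have hw0 : 0 < w := lt_min (lt_min (by linarith) (by linarith [hU.pos_c])) (by positivity)
  have hwX : w < X := by linarith [hU.pos_c, hU.c_lt]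
  refine ⟨w, hw0, hwX, strictAnti_nat_of_succ_lt fun n => ?_⟩
  cases n with
  | zero =>
    show mulFamily f w c < c
    rw [hU.mulFamily_c]
    linarith [hU.pos_c]
  | succ n =>
    obtain ⟨hmem, hle⟩ := hU.iterate_mem hw0 hwX (n + 1)
    have hle := hle (by omega)
    rw [iterate_mulFamily_succ w (n + 1)]
    set y := (mulFamily f w)^[n + 1] c
    have h1 := hball y (by
      rw [Metric.mem_ball, Real.dist_eq, sub_zero, abs_of_pos hmem.1]; linarith)
    rw [hU.zero, sub_zero, sub_zero, Real.norm_of_nonneg hmem.1.le] at h1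
    have h2 : (f y).re ≤ |M| * y := (le_abs_self _).trans
      (h1.trans (mul_le_mul_of_nonneg_right (le_abs_self M) hmem.1.le))
    have h3 : w * |M| < 1 := by
      rw [le_div_iff₀ hM1] at hwM
      nlinarith
    calc w * (f y).re ≤ w * (|M| * y) := by gcongr
      _ = w * |M| * y := by ring
      _ < 1 * y := mul_lt_mul_of_pos_right h3 hmem.1
      _ = y := one_mul y

/-- By analytic continuation along `(0, X)` the relation would persist to small parameters, where
the critical orbit is strictly decreasing. -/
theorem not_eventually_relation {a : ℝ} (ha : 0 < a) (haX : a < X) {q l : ℕ} (hlq : l < q) :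
    ¬ ∀ᶠ w in 𝓝 (a : ℂ), complexOrbit f c q w = complexOrbit f c l w := by
  intro hev
  obtain ⟨w, hw0, hwX, hanti⟩ := hU.exists_strictAnti hf hD
  have han : ∀ n, AnalyticOnNhd ℂ (complexOrbit f c n) ((fun x : ℝ => (x : ℂ)) '' Ioo 0 X) := by
    rintro n _ ⟨x, hx, rfl⟩
    exact hU.analyticAt_complexOrbit hf hD hx.1 hx.2 n
  have heq := (han q).eqOn_of_preconnected_of_eventuallyEq (han l)
    (isPreconnected_Ioo.image _ Complex.continuous_ofReal.continuousOn)
    (mem_image_of_mem _ ⟨ha, haX⟩) hev (mem_image_of_mem _ ⟨hw0, hwX⟩)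
  rw [hU.complexOrbit_ofReal hf hD hw0 hwX, hU.complexOrbit_ofReal hf hD hw0 hwX] at heq
  exact (hanti hlq).ne (by exact_mod_cast heq)

/-- Positively oriented transversality, for the explicit derivatives. -/
theorem transversality {O : Prop}
    (hcrit : ∀ v : ℂ, IsCriticalValue D f v → v = 0 ∨ v = 1 ∨ (O ∧ v = -1))
    (hodd : O → ∀ z ∈ D, f (-z) = -f z) {a : ℝ} (ha : 0 < a) (haX : a < X) {q l : ℕ} (hlq : l < q)
    (hql : (mulFamily f a)^[q] c = (mulFamily f a)^[l] c)
    (hinj : InjOn (fun k : ℕ => (mulFamily f a)^[k] c) (Iio q)) :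
    0 < (weightedDeriv (orbitMultiplier f c a) (orbitPartial f c a) 1 q -
      weightedDeriv (orbitMultiplier f c a) (orbitPartial f c a) 1 l) /
      ∏ k ∈ Finset.Ico 1 q, orbitMultiplier f c a k := by
  have hL0 : orbitPartial f c a 0 = 1 := hU.at_c
  rcases (show q = 1 ∨ 2 ≤ q by omega) with rfl | hq
  · obtain rfl : l = 0 := by omega
    simp [weightedDeriv, hL0]
  have hmem := fun n => (hU.iterate_mem ha haX n).1
  have hmemD : ∀ n, (((mulFamily f a)^[n] c : ℝ) : ℂ) ∈ D := fun n =>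
    hD _ ⟨(hmem n).1.le, (hmem n).2.le⟩
  have hne_c : ∀ i < q, i ≠ 0 → (mulFamily f a)^[i] c ≠ c := fun i hi hi0 h =>
    hi0 (hinj (show i ∈ Iio q from hi) (show 0 ∈ Iio q from by simp; omega) h)
  -- If `l = 1`, then `f` takes the value `1` at the point of index `q - 1`, which must be `c`,
  -- against injectivity of the orbit.
  have hl1 : l ≠ 1 := by
    rintro rfl
    obtain ⟨n, rfl⟩ : ∃ n, q = n + 1 := ⟨q - 1, by omega⟩
    rw [iterate_mulFamily_succ, Function.iterate_one, hU.mulFamily_c] at hql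
    exact hne_c n (by omega) (by omega) (hU.eq_c_of_re_eq_one (Ioo_subset_Ioc_self (hmem n))
      (mul_left_cancel₀ ha.ne' (hql.trans (mul_one a).symm)))
  have hp1 : (mulFamily f a)^[1] c = a := hU.mulFamily_c a
  have ha' : (a : ℂ) ≠ 0 := by exact_mod_cast ha.ne'
  have hderiv : ∀ i < q, i ≠ 0 → (deriv f ((mulFamily f a)^[i] c : ℝ)).re ≠ 0 := by
    intro i hi hi0
    rcases lt_or_gt_of_ne (hne_c i hi hi0) with h | h
    · exact (hU.deriv_pos _ ⟨(hmem i).1, h⟩).ne'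
    · exact (hU.deriv_neg _ ⟨h, (hmem i).2⟩).ne
  set p : ℕ → ℂ := fun i => (((mulFamily f a)^[i] c : ℝ) : ℂ) with hp
  have hP : FiniteCriticalOrbit D f O p q l :=
    { isOpen := hf.isOpen
      holo := hf.holo
      asymptotic := hf.asymptotic
      map_zero := hf.map_zero
      odd := hodd
      critical := hcrit
      two_le := hq
      lt := hlq
      ne_one := hl1
      mem := fun i _ => hmemD i
      map := fun i hi => by
        have h1 : p (nextIndex q l i) = (((mulFamily f a)^[i + 1] c : ℝ) : ℂ) := by
          unfold nextIndex
          split_ifs with h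
          · rw [h, hql]
          · rfl
        rw [h1, iterate_mulFamily_succ]
        simp only [hp, hp1]
        rw [Complex.ofReal_mul, mul_div_cancel_left₀ _ ha', ← hf.apply_ofReal (hmemD i)]
      deriv_ne_zero := fun i hi hi0 => by
        simp only [hp]
        rw [hf.deriv_ofReal (hmemD i)]
        exact_mod_cast hderiv i hi hi0 }
  have hM : IsMotion O p q (fun i _ => p i) :=
    { holo := fun i _ => differentiableOn_const _
      base := fun i _ => rfl
      fix := fun z _ => rfl
      ne_zero := fun i _ z _ => by
        have := (hmem i).1.ne'
        simp only [hp]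
        exact_mod_cast this
      inj := fun i hi j hj hij z _ h => hij (hinj hi hj (by simpa [hp] using h))
      odd := fun _ i _ j _ z _ h => by
        have h1 : (mulFamily f a)^[i] c = -(mulFamily f a)^[j] c := by
          simp only [hp] at h
          exact_mod_cast h
        linarith [(hmem i).1, (hmem j).1] }
  have hfc : f c = 1 := by
    have := hf.apply_ofReal (hmemD 0)
    simpa [hU.at_c] using this
  have hshift : Tendsto (fun z : ℂ => (a : ℂ) + z) (𝓝 0) (𝓝 a) := by
    have : Tendsto (fun z : ℂ => (a : ℂ) + z) (𝓝 0) (𝓝 (a + 0)) :=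
      (continuous_const.add continuous_id).tendsto 0
    rwa [add_zero] at this
  have hstep : ∀ i z, f (complexOrbit f c i (a + z)) * complexOrbit f c 1 (a + z) =
      complexOrbit f c (i + 1) (a + z) := by
    intro i z
    simp only [complexOrbit, hfc]
    ring
  refine hP.weightedDeriv_pos hM (γ := fun i z => complexOrbit f c i (a + z)) (fun i _ => ?_)
    (fun i _ => ?_) (fun z => rfl) (fun i _ _ => Eventually.of_forall (hstep i)) ?_ hL0
    (fun i _ => hf.apply_ofReal (hmemD i)) (fun i hi hi0 => ?_)
  · refine AnalyticAt.fun_comp ?_ (by fun_prop)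
    rw [add_zero]
    exact hU.analyticAt_complexOrbit hf hD ha haX i
  · rw [add_zero]
    exact hU.complexOrbit_ofReal hf hD ha haX i
  · intro hev
    refine hU.not_eventually_relation hf hD ha haX hlq ?_
    have hback : Tendsto (fun w : ℂ => w - a) (𝓝 (a : ℂ)) (𝓝 0) := by
      have : Tendsto (fun w : ℂ => w - a) (𝓝 (a : ℂ)) (𝓝 (a - a)) :=
        (continuous_id.sub continuous_const).tendsto _
      rwa [sub_self] at this
    filter_upwards [hback.eventually hev] with w hw
    rw [hstep, show q - 1 + 1 = q by omega, add_sub_cancel] at hw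
    exact sub_eq_zero.1 hw
  · simp only [hp, hp1, orbitMultiplier]
    rw [hf.deriv_ofReal (hmemD i), ← Complex.ofReal_mul, Complex.ofReal_re]

end IsUnimodalOn

end CriticalOrbits

/-! ### From transversality to monotonicity of kneading sequences. -/

section Monotonicity

variable {D : Set ℂ} {f : ℂ → ℂ} {c X : ℝ}

/-- A function whose derivative is positive at each of its zeros crosses zero at most once, from
below to above. -/
theorem pos_of_deriv_pos_at_zeros {g g' : ℝ → ℝ} {a b : ℝ} (hab : a < b)
    (hg : ∀ t ∈ Icc a b, HasDerivAt g (g' t) t) (hz : ∀ t ∈ Icc a b, g t = 0 → 0 < g' t)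
    (ha : 0 ≤ g a) : 0 < g b := by
  by_contra! hb
  have hslope : ∀ t ∈ Icc a b, g t = 0 → ∀ᶠ s in 𝓝[≠] t, 0 < (s - t)⁻¹ * g s := by
    intro t ht h0
    have := (hasDerivAt_iff_tendsto_slope.1 (hg t ht)).eventually (lt_mem_nhds (hz t ht h0))
    filter_upwards [this] with s hs
    simpa [slope_def_module, h0] using hs
  obtain ⟨a₁, ha₁, hpos⟩ : ∃ a₁ ∈ Ico a b, 0 < g a₁ := by
    rcases ha.lt_or_eq with h | h
    · exact ⟨a, ⟨le_rfl, hab⟩, h⟩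
    · have h1 := (hslope a ⟨le_rfl, hab.le⟩ h.symm).filter_mono (nhdsGT_le_nhdsNE a)
      obtain ⟨s, hs, hs'⟩ := (h1.and (Ioo_mem_nhdsGT hab)).exists
      exact ⟨s, ⟨hs'.1.le, hs'.2⟩, pos_of_mul_pos_right hs (inv_pos.2 (sub_pos.2 hs'.1)).le⟩
  have hcont : ContinuousOn g (Icc a₁ b) := fun t ht =>
    (hg t ⟨ha₁.1.trans ht.1, ht.2⟩).continuousAt.continuousWithinAt
  have hcomp : IsCompact (Icc a₁ b ∩ g ⁻¹' Iic 0) :=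
    isCompact_Icc.of_isClosed_subset (hcont.preimage_isClosed_of_isClosed isClosed_Icc isClosed_Iic)
      inter_subset_left
  -- At the first later zero `g` comes down from positive values, which its positive derivative
  -- forbids.
  obtain ⟨t, ⟨ht, ht0⟩, hleast⟩ := hcomp.exists_isLeast ⟨b, ⟨ha₁.2.le, le_rfl⟩, hb⟩
  have hat : a₁ < t := lt_of_le_of_ne ht.1 (by rintro rfl; exact absurd hpos (not_lt.2 ht0))
  have hbefore : ∀ s ∈ Ioo a₁ t, 0 < g s := by
    intro s hs
    by_contra! h
    exact absurd (hleast ⟨⟨hs.1.le, hs.2.le.trans ht.2⟩, h⟩) (not_le.2 hs.2)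
  have htmem : t ∈ Icc a b := ⟨ha₁.1.trans ht.1, ht.2⟩
  have hge : 0 ≤ g t := by
    refine ge_of_tendsto ((hg t htmem).continuousAt.tendsto.mono_left
      (nhdsWithin_le_nhds (s := Iio t))) ?_
    filter_upwards [Ioo_mem_nhdsLT hat] with s hs
    exact (hbefore s hs).le
  have h1 := (hslope t htmem (le_antisymm ht0 hge)).filter_mono (nhdsLT_le_nhdsNE t)
  obtain ⟨s, hs, hs'⟩ := (h1.and (Ioo_mem_nhdsLT hat)).exists
  have h2 := mul_neg_of_neg_of_pos (inv_lt_zero.2 (sub_neg.2 hs'.2)) (hbefore s hs')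
  exact lt_asymm hs h2

/-- Two sequences in strict order are compared at the first place where they differ. -/
theorem KneadingLT.lt_of_first_diff {i j : ℕ → SignType} (h : KneadingLT i j) {m : ℕ} (hm : 1 ≤ m)
    (heq : ∀ k, 1 ≤ k → k < m → i k = j k) (hne : i m ≠ j m) :
    (∏ k ∈ Finset.Ico 1 m, -i k) * i m < (∏ k ∈ Finset.Ico 1 m, -i k) * j m := by
  have hprod : ∀ n, (∀ k, 1 ≤ k → k < n → i k = j k) →
      ∏ k ∈ Finset.Ico 1 n, -j k = ∏ k ∈ Finset.Ico 1 n, -i k := fun n hn =>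
    Finset.prod_congr rfl fun k hk => by
      rw [Finset.mem_Ico] at hk; rw [hn k hk.1 hk.2]
  obtain ⟨n, hn, hneq, hlt⟩ := h
  rw [hprod n hneq] at hlt
  obtain rfl : n = m := by
    rcases lt_trichotomy n m with h | h | h
    · rw [heq n hn h] at hlt; exact absurd hlt (lt_irrefl _)
    · exact h
    · exact absurd (hneq m hm h) hne
  exact hlt

/-- A function between two functions which agree up to `n` also agrees with them up to `n`. -/
theorem eq_of_kneading_between {i j k : ℕ → SignType} {n : ℕ}
    (hik : ∀ m, 1 ≤ m → m ≤ n → i m = k m)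
    (hij : (∀ m, 1 ≤ m → m ≤ n → i m = j m) ∨ KneadingLT i j)
    (hjk : (∀ m, 1 ≤ m → m ≤ n → j m = k m) ∨ KneadingLT j k) :
    ∀ m, 1 ≤ m → m ≤ n → i m = j m := by
  intro m
  induction m using Nat.strong_induction_on with
  | _ m ih =>
    intro hm hmn
    by_contra hne
    have heq : ∀ k, 1 ≤ k → k < m → i k = j k := fun k hk hkm => ih k hkm hk (hkm.le.trans hmn)
    have h1 : KneadingLT i j := hij.resolve_left fun h => hne (h m hm hmn)
    have h2 : KneadingLT j k := hjk.resolve_left fun h => hne (by rw [hik m hm hmn, h m hm hmn])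
    -- At the first place where `j` leaves the common prefix, it would lie both strictly above and
    -- strictly below the same entry.
    have h3 := h1.lt_of_first_diff hm heq hne
    have h4 := h2.lt_of_first_diff hm
      (fun l hl hlm => by rw [← heq l hl hlm, hik l hl (hlm.le.trans hmn)])
      (by rw [← hik m hm hmn]; exact Ne.symm hne)
    have h5 : ∏ k ∈ Finset.Ico 1 m, -j k = ∏ k ∈ Finset.Ico 1 m, -i k :=
      Finset.prod_congr rfl fun k hk => by
        rw [Finset.mem_Ico] at hk; rw [heq k hk.1 hk.2]
    rw [h5, ← hik m hm hmn] at h4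
    exact lt_asymm h3 h4

theorem kneading_add_of_eq_zero {g : ℝ → ℝ} {k : ℕ} (h : kneading g c k = 0) (m : ℕ) :
    kneading g c (m + k) = kneading g c m := by
  have hk : g^[k] c = c := by
    rw [kneading, sign_eq_zero_iff] at h
    linarith
  rw [kneading, kneading, Function.iterate_add_apply, hk]

/-- Kneading sequences which agree up to a common zero agree. -/
theorem kneading_eq_of_zero {g g' : ℝ → ℝ} {k : ℕ} (hk : 1 ≤ k) (h : kneading g c k = 0)
    (heq : ∀ m, 1 ≤ m → m ≤ k → kneading g c m = kneading g' c m) :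
    ∀ m, 1 ≤ m → kneading g c m = kneading g' c m := by
  intro m
  induction m using Nat.strong_induction_on with
  | _ m ih =>
    intro hm
    rcases le_or_gt m k with hmk | hmk
    · exact heq m hm hmk
    · obtain ⟨n, rfl⟩ : ∃ n, m = n + k := ⟨m - k, by omega⟩
      have h' : kneading g' c k = 0 := by rw [← heq k hk le_rfl, h]
      rw [kneading_add_of_eq_zero h, kneading_add_of_eq_zero h']
      exact ih n (by omega) (by omega)

/-- Before its first return the orbit of a periodic point is injective. -/
theorem injOn_iterate_of_first_return {g : ℝ → ℝ} {q : ℕ} (hq : g^[q] c = c)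
    (hne : ∀ k, 1 ≤ k → k < q → g^[k] c ≠ c) : InjOn (fun k : ℕ => g^[k] c) (Iio q) := by
  have key : ∀ i j, i < j → j < q → g^[i] c ≠ g^[j] c := by
    intro i j hij hj h
    refine hne (q - j + i) (by omega) (by omega) ?_
    rw [Function.iterate_add_apply, h, ← Function.iterate_add_apply, Nat.sub_add_cancel hj.le, hq]
  intro i hi j hj h
  rcases lt_trichotomy i j with hij | hij | hij
  · exact absurd h (key i j hij hj)
  · exact hij
  · exact absurd h.symm (key j i hij hi)

namespace IsUnimodalOn

variable {O : Prop} (hU : IsUnimodalOn f c X) (hf : IsRealSurjective D f)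
  (hD : ∀ y ∈ Icc 0 X, (y : ℂ) ∈ D)
  (hcrit : ∀ v : ℂ, IsCriticalValue D f v → v = 0 ∨ v = 1 ∨ (O ∧ v = -1))
  (hodd : O → ∀ z ∈ D, f (-z) = -f z)
include hU hf hD hcrit hodd

/-- The least `q` whose iterate repeats an earlier one, of index `l`, makes the preceding points
distinct; `l = 0` is the periodic case and `l > 0` the strictly preperiodic one. -/
theorem positiveTransversality {a : ℝ} (ha : 0 < a) (haX : a < X)
    (hper : ∃ m : ℕ, (mulFamily f a)^[m] c ∈ Function.periodicPts (mulFamily f a)) :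
    PositiveTransversality (mulFamily f) c a := by
  classical
  have hex : ∃ q l, l < q ∧ (mulFamily f a)^[q] c = (mulFamily f a)^[l] c := by
    obtain ⟨m, N, hN, hN'⟩ := hper
    refine ⟨N + m, m, by omega, ?_⟩
    rw [Function.iterate_add_apply]
    exact hN'
  obtain ⟨l, hlq, hql⟩ := Nat.find_spec hex
  have hmin := fun n (hn : n < Nat.find hex) => Nat.find_min hex hn
  set q := Nat.find hex
  have hinj : InjOn (fun k : ℕ => (mulFamily f a)^[k] c) (Iio q) := by
    intro i hi j hj h
    rcases lt_trichotomy i j with hij | hij | hij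
    · exact absurd ⟨i, hij, h.symm⟩ (hmin j hj)
    · exact hij
    · exact absurd ⟨j, hij, h⟩ (hmin i hi)
  have hpos := hU.transversality hf hD hcrit hodd ha haX hlq hql hinj
  have hden : deriv ((mulFamily f a)^[q - 1]) (mulFamily f a c) =
      ∏ k ∈ Finset.Ico 1 q, orbitMultiplier f c a k := by
    rw [(hU.hasDerivAt_iterate hf hD ha haX (q - 1)).deriv, Nat.sub_add_cancel (by omega)]
  have hnum := ((hU.hasDerivAt_param hf hD ha haX q).sub (hU.hasDerivAt_param hf hD ha haX l)).deriv
  rcases Nat.eq_zero_or_pos l with rfl | hl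
  · refine Or.inl ⟨q, hlq, hql, fun k hk hkq h => hk.ne' (hinj (show k ∈ Iio q from hkq)
      (show 0 ∈ Iio q from hlq) h), ?_⟩
    rw [hden]
    refine hpos.trans_eq ?_
    rw [← hnum]
    rfl
  · refine Or.inr ⟨l, q, hl, hlq, hql, hinj, ?_⟩
    rw [hden]
    refine hpos.trans_eq ?_
    rw [← hnum]
    rfl

/-- Monotonicity of the kneading sequence up to the entry `n`. -/
theorem kneading_prefix_le (n : ℕ) : ∀ a a' : ℝ, 0 < a → a ≤ a' → a' < X →
    (∀ m, 1 ≤ m → m ≤ n → kneading (mulFamily f a) c m = kneading (mulFamily f a') c m) ∨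
      KneadingLT (kneading (mulFamily f a) c) (kneading (mulFamily f a') c) := by
  induction n with
  | zero => exact fun a a' _ _ _ => Or.inl fun m hm hm' => absurd hm' (by omega)
  | succ n ih =>
    intro a a' ha haa' ha'X
    rcases ih a a' ha haa' ha'X with heq | hlt
    swap
    · exact Or.inr hlt
    -- A zero entry means that `c` has returned, so both sequences are periodic and agree forever.
    by_cases hzero : ∃ k, 1 ≤ k ∧ k ≤ n ∧ kneading (mulFamily f a) c k = 0
    · obtain ⟨k, hk, hkn, h0⟩ := hzero
      exact Or.inl fun m hm _ => kneading_eq_of_zero hk h0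
        (fun m hm hmk => heq m hm (hmk.trans hkn)) m hm
    push Not at hzero
    by_cases hlast : kneading (mulFamily f a) c (n + 1) = kneading (mulFamily f a') c (n + 1)
    · refine Or.inl fun m hm hmn => ?_
      rcases hmn.lt_or_eq with h | rfl
      · exact heq m hm (by omega)
      · exact hlast
    refine Or.inr ⟨n + 1, by omega, fun k hk hkn => heq k hk (by omega), ?_⟩
    have hne : a ≠ a' := by rintro rfl; exact hlast rfl
    have hlt : a < a' := lt_of_le_of_ne haa' hne
    -- The induction hypothesis on `[a, t]` and `[t, a']` squeezes the prefix, which is thus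
    -- constant on `[a, a']`; hence so is the sign of `P t`.
    have hpre : ∀ t ∈ Icc a a', ∀ m, 1 ≤ m → m ≤ n →
        kneading (mulFamily f a) c m = kneading (mulFamily f t) c m := fun t ht =>
      eq_of_kneading_between heq (ih a t ha ht.1 (ht.2.trans_lt ha'X))
        (ih t a' (ha.trans_le ht.1) ht.2 ha'X)
    set P : ℝ → ℝ := fun t => ∏ k ∈ Finset.Ico 1 (n + 1), orbitMultiplier f c t k with hP
    have hsignP : ∀ t ∈ Icc a a', SignType.sign (P t) =
        ∏ k ∈ Finset.Ico 1 (n + 1), -kneading (mulFamily f a) c k := by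
      intro t ht
      have h1 : SignType.sign (P t) =
          ∏ k ∈ Finset.Ico 1 (n + 1), SignType.sign (orbitMultiplier f c t k) :=
        map_prod (signHom : ℝ →*₀ SignType) _ _
      rw [h1]
      refine Finset.prod_congr rfl fun k hk => ?_
      rw [Finset.mem_Ico] at hk
      rw [hU.sign_orbitMultiplier (ha.trans_le ht.1) (ht.2.trans_lt ha'X),
        hpre t ht k hk.1 (by omega)]
    -- The factor `P a` carries the orientation sign of the order, so comparing the sequences means
    -- comparing the signs of `g a` and `g a'`.
    set g : ℝ → ℝ := fun t => P a * ((mulFamily f t)^[n + 1] c - c) with hg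
    have hsigng : ∀ t, SignType.sign (g t) =
        (∏ k ∈ Finset.Ico 1 (n + 1), -kneading (mulFamily f a) c k) *
          kneading (mulFamily f t) c (n + 1) := by
      intro t
      rw [hg, sign_mul, hsignP a ⟨le_rfl, haa'⟩]
      rfl
    have hprod' : ∏ k ∈ Finset.Ico 1 (n + 1), -kneading (mulFamily f a') c k =
        ∏ k ∈ Finset.Ico 1 (n + 1), -kneading (mulFamily f a) c k :=
      Finset.prod_congr rfl fun k hk => by
        rw [Finset.mem_Ico] at hk; rw [heq k hk.1 (by omega)]
    have hPa : P a ≠ 0 := by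
      rw [← sign_ne_zero, hsignP a ⟨le_rfl, haa'⟩, Finset.prod_ne_zero_iff]
      intro k hk
      rw [Finset.mem_Ico] at hk
      have := hzero k hk.1 (by omega)
      revert this
      generalize kneading (mulFamily f a) c k = s
      revert s
      decide
    have hne' : SignType.sign (g a) ≠ SignType.sign (g a') := by
      intro h
      apply hlast
      simp only [hg, sign_mul] at h
      exact mul_left_cancel₀ (sign_ne_zero.2 hPa) h
    rw [hprod', ← hsigng a, ← hsigng a']
    refine lt_of_le_of_ne ?_ hne'
    -- At a zero of `g` the turning point has exact period `n + 1`, since the earlier entries are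
    -- nonzero. Transversality and the constant sign of `P` then make the derivative of `g`
    -- positive.
    have hcross : 0 ≤ g a → 0 < g a' := by
      refine pos_of_deriv_pos_at_zeros hlt (g' := fun t => P a *
        weightedDeriv (orbitMultiplier f c t) (orbitPartial f c t) 1 (n + 1)) (fun t ht => ?_)
        fun t ht h0 => ?_
      · exact ((hU.hasDerivAt_param hf hD (ha.trans_le ht.1) (ht.2.trans_lt ha'X)
          (n + 1)).sub_const c).const_mul (P a)
      · have hret : (mulFamily f t)^[n + 1] c = c :=
          sub_eq_zero.1 ((mul_eq_zero.1 h0).resolve_left hPa)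
        have hno : ∀ k, 1 ≤ k → k < n + 1 → (mulFamily f t)^[k] c ≠ c := by
          intro k hk hkn h
          apply hzero k hk (by omega)
          rw [hpre t ht k hk (by omega), kneading, h, sub_self, sign_zero]
        have h1 := hU.transversality hf hD hcrit hodd (ha.trans_le ht.1) (ht.2.trans_lt ha'X)
          (l := 0) (Nat.succ_pos n) hret (injOn_iterate_of_first_return hret hno)
        have h2 : (weightedDeriv (orbitMultiplier f c t) (orbitPartial f c t) 1 0) = 0 := rfl
        rw [h2, sub_zero] at h1
        have h3 : SignType.sign (P t) = SignType.sign (P a) := by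
          rw [hsignP t ht, hsignP a ⟨le_rfl, haa'⟩]
        have h4 : 0 < P t * weightedDeriv (orbitMultiplier f c t) (orbitPartial f c t) 1 (n + 1) := by
          rw [mul_comm]
          rcases div_pos_iff.1 h1 with ⟨h5, h6⟩ | ⟨h5, h6⟩
          · exact mul_pos h5 h6
          · exact mul_pos_of_neg_of_neg h5 h6
        rw [← sign_eq_one_iff, sign_mul] at h4 ⊢
        rw [← h3, h4]
    rcases lt_or_ge (g a) 0 with h | h
    · rw [sign_neg h]
      exact bot_le
    · rw [sign_pos (hcross h)]
      exact le_top

theorem kneadingLE {a a' : ℝ} (ha : 0 < a) (haa' : a ≤ a') (ha'X : a' < X) :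
    KneadingLE (kneading (mulFamily f a) c) (kneading (mulFamily f a') c) := by
  by_cases h : KneadingLT (kneading (mulFamily f a) c) (kneading (mulFamily f a') c)
  · exact Or.inr h
  · exact Or.inl fun k hk => ((hU.kneading_prefix_le hf hD hcrit hodd k a a' ha haa'
      ha'X).resolve_right h) k hk le_rfl

end IsUnimodalOn

theorem exists_of_lt_unimodalEnd {a : ℝ} (h : (a : EReal) < unimodalEnd D f c) :
    ∃ X, a < X ∧ c < X ∧ ∀ y ∈ Icc c X, (y : ℂ) ∈ D ∧ 0 < (f y).re := by
  obtain ⟨_, ⟨X, ⟨hX, hXD⟩, rfl⟩, haX⟩ := lt_sSup_iff.1 h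
  exact ⟨X, EReal.coe_lt_coe_iff.1 haX, hX, hXD⟩

end Monotonicity

theorem mainTheorem7 (D : Set ℂ) (f : ℂ → ℂ) (c : ℝ) (hc : IsFirstPositiveMax D f c)
    (hf : ClassE D f ∨ (ClassEo D f ∧ ∀ x ∈ Ioo 0 c, 0 < (f (x : ℝ)).re)) :
    (∀ a : ℝ, 0 < a → (a : EReal) < unimodalEnd D f c →
      (∃ m : ℕ, (mulFamily f a)^[m] c ∈ Function.periodicPts (mulFamily f a)) →
      PositiveTransversality (mulFamily f) c a) ∧
    (∀ a a' : ℝ, 0 < a → a ≤ a' → (a' : EReal) < unimodalEnd D f c →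
      KneadingLE (kneading (mulFamily f a) c) (kneading (mulFamily f a') c)) := by
  -- The proposition `O` treats both classes at once: it is `False` for `ClassE` and `True` for
  -- `ClassEo`.
  obtain ⟨O, hR, hcrit, hodd, hpos⟩ : ∃ O : Prop, IsRealSurjective D f ∧
      (∀ v : ℂ, IsCriticalValue D f v → v = 0 ∨ v = 1 ∨ (O ∧ v = -1)) ∧
      (O → ∀ z ∈ D, f (-z) = -f z) ∧ ∀ y ∈ Ioo 0 c, 0 < (f (y : ℝ)).re := by
    rcases hf with hf | ⟨hf, hpos⟩
    · exact ⟨False, hf.toIsRealSurjective,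
        fun v hv => (hf.critical v hv).elim (fun h => Or.inr (Or.inl h)) Or.inl, False.elim,
        hf.pos_of_mem hc⟩
    · refine ⟨True, hf.toIsRealSurjective, fun v hv => ?_, fun _ z hz => (hf.odd z hz).2, hpos⟩
      rcases hf.critical v hv with h | h | h
      · exact Or.inr (Or.inl h)
      · exact Or.inr (Or.inr ⟨trivial, h⟩)
      · exact Or.inl h
  have hU : ∀ a : ℝ, (a : EReal) < unimodalEnd D f c →
      ∃ X, a < X ∧ IsUnimodalOn f c X ∧ ∀ y ∈ Icc 0 X, (y : ℂ) ∈ D := by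
    intro a ha
    obtain ⟨X, haX, hcX, hXD⟩ := exists_of_lt_unimodalEnd ha
    exact ⟨X, haX, hc.isUnimodalOn hR hcrit hpos hcX hXD,
      hR.Icc_mem (hXD X ⟨hcX.le, le_rfl⟩).1⟩
  constructor
  · intro a ha hab hper
    obtain ⟨X, haX, hU, hD⟩ := hU a hab
    exact hU.positiveTransversality hR hD hcrit hodd ha haX hper
  · intro a a' ha haa' hab
    obtain ⟨X, haX, hU, hD⟩ := hU a' hab
    exact hU.kneadingLE hR hD hcrit hodd ha haa' haX
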